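/- **Theorem (tree-determinant expansion of the cumulants).** *Setting.* Let $\Omega$ be a finite set of single-particle states, let $\psi_a,\psi_a^\dagger$ ($a\in\Omega$) be the fermionic annihilation and creation operators on the Fock space over $\Omega$, let $h=(h_{ab})_{a,b\in\Omega}$ be a Hermitian matrix, $H_0=\sum_{a,b}h_{ab}\psi_a^\dagger\psi_b$ and $\beta\in\mathbb R$. Put $A(\tau)=e^{\tau H_0}Ae^{-\tau H_0}$, $\langle A\rangle_0=\mathrm{Tr}(Ae^{-\beta H_0})/\mathrm{Tr}(e^{-\beta H_0})$, and let $$g_\tau(a,b)=\begin{cases}\langle\psi_a(\tau)\psi_b^\dagger\rangle_0,&\tau>0,\\-\langle\psi_b^\dagger\psi_a(\tau)\rangle_0,&\tau\le 0\end{cases}$$ be the time-ordered Green's function, with the normal-ordered value at equal times. Let $s\ge1$. For $i\in[s]=\{1,\dots,s\}$ let $P_i$ consist of $P_i^+,P_i^-\in\Omega^{m_i}$, put $\Psi_{P_i}=\psi^\dagger_{P_i^+(1)}\cdots\psi^\dagger_{P_i^+(m_i)}\psi_{P_i^-(1)}\cdots\psi_{P_i^-(m_i)}$, and let $\tau_1,\dots,\tau_s\in\mathbb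 R$ be pairwise distinct. For $B\subseteq[s]$ let $\mathcal E(B)=\langle\mathcal T\prod_{i\in B}\Psi_{P_i}(\tau_i)\rangle_0$, where $\mathcal T$ orders the factors by decreasing time, and define the connected correlation $$\mathcal E_c(\{P_i,\tau_i\}_{i\in[s]})=\sum_{\Pi}(-1)^{|\Pi|-1}(|\Pi|-1)!\prod_{B\in\Pi}\mathcal E(B),$$ the sum being over all set partitions $\Pi$ of $[s]$. *Trees and contractions.* Let $\mathcal T([s])$ be the set of labeled trees on $[s]$; edges are written $(i,j)$ with $i<j$. For $T\in\mathcal T([s])$ let $\mathcal A(T)$ be the set of maps $\chi$ that assign to each edge $(i,j)$ of $T$ a triple $\chi_{ij}=(\sigma,k,l)$, $\sigma\in\{\pm1\}$, $1\le k\le m_i$, $1\le l\le m_j$, where $\chi_{ij}=(-1,k,l)$ contracts the annihilation operator $P_i^-(k)$ with the creation operator $P_j^+(l)$, and $\chi_{ij}=(+1,k,l)$ contracts $P_j^-(l)$ with $P_i^+(k)$, such that no operator is contracted more than once. Put $g_{\tau_i,\tau_j}(P_i,P_j,\chi_{ij})=g_{\tau_i-\tau_j}(P_i^-(k),P_j^+(l))$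 if $\sigma=-1$ and $g_{\tau_j-\tau_i}(P_j^-(l),P_i^+(k))$ if $\sigma=+1$. *Sign.* Give $P_i^-(k)$ the row number and $P_i^+(k)$ the column number $\sum_{r<i}m_r+k$, and let $\mathrm{inv}(\chi)$ be the number of unordered pairs of edges of $T$ whose contracted rows and contracted columns are in opposite order. Put $$\alpha_{T,\chi}=(-1)^{\mathrm{inv}(\chi)}\prod_{i=1}^s(-1)^{m_i(m_i+1)/2}\prod_{(i,j)\in T}(-1)^{\sum_{r<i}m_r+\sum_{r<j}m_r+k+l}\qquad(\chi_{ij}=(\sigma,k,l)).$$ *Growing paths and weights.* Root $T$ at $1$. Let $S(T)$ be the set of orderings $\omega(1),\dots,\omega(s)$ of $[s]$ with $\omega(1)=1$ in which the parent of each vertex precedes it. Let $X_i=\{\omega(1),\dots,\omega(i)\}$; a pair $(j,k)$ crosses $X_i$ if exactly one of $j,k$ lies in $X_i$; $b_i$ is the number of edges of $T$ that cross $X_i$. For $\mathbf t\in[0,1]^{s-1}$ put $p_{T,\omega}(\mathbf t)=\prod_{i=1}^{s-1}t_i^{b_i-1}$ and let $a(\omega,\mathbf t)_{jk}$ be the product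 of the $t_i$, $1\le i\le s-1$, for which $(j,k)$ crosses $X_i$. Let $\mathbf G(T,\chi,\omega,\mathbf t)$ be the matrix with the blocks $\big(a(\omega,\mathbf t)_{ij}\,g_{\tau_i-\tau_j}(P_i^-(k),P_j^+(l))\big)_{k\le m_i,\,l\le m_j}$, $i,j\in[s]$, from which the rows and columns of the operators contracted by $\chi$ are deleted. *Claim.* $$\mathcal E_c(\{P_i,\tau_i\}_{i\in[s]})=\sum_{T\in\mathcal T([s])}\ \sum_{\chi\in\mathcal A(T)}\alpha_{T,\chi}\prod_{(i,j)\in T}g_{\tau_i,\tau_j}(P_i,P_j,\chi_{ij})\;h_{\boldsymbol\tau}(P_1,\dots,P_s,T,\chi),$$ $$h_{\boldsymbol\tau}(P_1,\dots,P_s,T,\chi)=\sum_{\omega\in S(T)}\int_{[0,1]^{s-1}}p_{T,\omega}(\mathbf t)\,\det\mathbf G(T,\chi,\omega,\mathbf t)\,d\mathbf t.$$ -/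

import Mathlib

noncomputable section

namespace TreeDet

/-! ### The fermionic system -/

section Fock

variable {Ω : Type*} [Fintype Ω] [LinearOrder Ω]

/-- Operators on the fermionic Fock space over the finite set `Ω` of single-particle states, as
matrices in the occupation-number basis: the basis vector `S : Finset Ω` is the state in which
exactly the single-particle states of `S` are occupied. -/
abbrev FockOp (Ω : Type*) := Matrix (Finset Ω) (Finset Ω) ℂ

/-- The annihilation operator `ψ_a`: it maps the basis vector `S` to
`(-1) ^ #{b ∈ S | b < a}` times the basis vector `S \ {a}` if `a ∈ S`, and to `0` otherwise. -/
def annih (a : Ω) : FockOp Ω :=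
  Matrix.of fun S' S =>
    if a ∈ S ∧ S' = S.erase a then (-1 : ℂ) ^ (S.filter (· < a)).card else 0

/-- The creation operator `ψ_a†`, the adjoint of `ψ_a`. -/
def creat (a : Ω) : FockOp Ω := (annih a).conjTranspose

/-- The free Hamiltonian `H₀ = ∑_{a,b} h_{ab} ψ_a† ψ_b`. -/
def freeHam (h : Matrix Ω Ω ℂ) : FockOp Ω :=
  ∑ a, ∑ b, h a b • (creat a * annih b)

/-- Imaginary-time evolution `A(τ) = e^{τ H₀} A e^{-τ H₀}`. -/
def evolve (h : Matrix Ω Ω ℂ) (τ : ℝ) (A : FockOp Ω) : FockOp Ω :=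
  NormedSpace.exp ((τ : ℂ) • freeHam h) * A * NormedSpace.exp (-((τ : ℂ) • freeHam h))

/-- The free thermal expectation `⟨A⟩₀ = Tr(A e^{-β H₀}) / Tr(e^{-β H₀})`. -/
def thermal (β : ℝ) (h : Matrix Ω Ω ℂ) (A : FockOp Ω) : ℂ :=
  (A * NormedSpace.exp (-((β : ℂ) • freeHam h))).trace /
    (NormedSpace.exp (-((β : ℂ) • freeHam h)) : FockOp Ω).trace

/-- The time-ordered free Green's function: `g_τ(a,b) = ⟨ψ_a(τ) ψ_b†⟩₀` for `τ > 0` and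
`g_τ(a,b) = -⟨ψ_b† ψ_a(τ)⟩₀` for `τ ≤ 0`. At equal times it takes the normal-ordered value
(the limit `τ → 0⁻`), as the interaction terms are normally ordered. -/
def green (β : ℝ) (h : Matrix Ω Ω ℂ) (τ : ℝ) (a b : Ω) : ℂ :=
  if τ ≤ 0 then -thermal β h (creat b * evolve h τ (annih a))
  else thermal β h (evolve h τ (annih a) * creat b)

/-- A multi-index `P`: `m` creation sites `P⁺(1), …, P⁺(m)` and `m` annihilation sites
`P⁻(1), …, P⁻(m)`. -/
structure Interaction (Ω : Type*) where
  m : ℕ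
  plus : Fin m → Ω
  minus : Fin m → Ω

/-- `Ψ_P = ψ†_{P⁺(1)} ⋯ ψ†_{P⁺(m)} ψ_{P⁻(1)} ⋯ ψ_{P⁻(m)}`. -/
def Interaction.op (P : Interaction Ω) : FockOp Ω :=
  (List.ofFn fun j => creat (P.plus j)).prod * (List.ofFn fun j => annih (P.minus j)).prod

variable {s : ℕ}

/-- The indices of `B` in the order of decreasing times. -/
def timeOrder (τ : Fin s → ℝ) (B : Finset (Fin s)) : List (Fin s) :=
  (B.sort (· ≤ ·)).insertionSort fun i j => τ j ≤ τ i

/-- The time-ordered correlation `ℰ({P_i, τ_i}_{i ∈ B}) = ⟨𝒯 ∏_{i ∈ B} Ψ_{P_i}(τ_i)⟩₀`. -/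
def correlation (β : ℝ) (h : Matrix Ω Ω ℂ) (P : Fin s → Interaction Ω) (τ : Fin s → ℝ)
    (B : Finset (Fin s)) : ℂ :=
  thermal β h ((timeOrder τ B).map fun i => evolve h (τ i) (P i).op).prod

/-- The cumulant (connected correlation)
`ℰ_c = ∑_Π (-1)^{|Π|-1} (|Π|-1)! ∏_{B ∈ Π} ℰ({P_i, τ_i}_{i ∈ B})`, summed over all set partitions
`Π` of the index set. -/
def cumulant (β : ℝ) (h : Matrix Ω Ω ℂ) (P : Fin s → Interaction Ω) (τ : Fin s → ℝ) : ℂ :=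
  ∑ Q : Finpartition (Finset.univ : Finset (Fin s)),
    (-1 : ℂ) ^ (Q.parts.card - 1) * ((Q.parts.card - 1).factorial : ℂ) *
      ∏ B ∈ Q.parts, correlation β h P τ B

end Fock

/-! ### Trees, contraction assignments, signs -/

section Trees

/-- The set of labeled trees on `[s]`. -/
abbrev LabeledTree (s : ℕ) := {T : SimpleGraph (Fin s) // T.IsTree}

open scoped Classical in
instance (s : ℕ) : Fintype (LabeledTree s) := inferInstance

variable {Ω : Type*} {s : ℕ}

/-- The edges of `T`, written as pairs `(i, j)` with `i < j`. -/
abbrev Edge (T : LabeledTree s) := {e : Fin s × Fin s // e.1 < e.2 ∧ T.1.Adj e.1 e.2}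

open scoped Classical in
instance (T : LabeledTree s) : Fintype (Edge T) := inferInstance

/-- A choice of `χ_{ij} = (σ, k, l)`, with `σ = ±1`, `k ∈ [m_{P_i}]` and `l ∈ [m_{P_j}]`, for every
edge `(i, j)` of the tree. -/
abbrev PreAssignment (P : Fin s → Interaction Ω) (T : LabeledTree s) :=
  (e : Edge T) → ℤˣ × Fin (P e.1.1).m × Fin (P e.1.2).m

variable {P : Fin s → Interaction Ω} {T : LabeledTree s}

/-- The annihilation operator contracted at the edge `(i, j)`: `P_j⁻(l)` if `σ = 1` and `P_i⁻(k)` if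
`σ = -1`. -/
def annihLeg (χ : PreAssignment P T) (e : Edge T) : (i : Fin s) × Fin (P i).m :=
  if (χ e).1 = 1 then ⟨e.1.2, (χ e).2.2⟩ else ⟨e.1.1, (χ e).2.1⟩

/-- The creation operator contracted at the edge `(i, j)`: `P_i⁺(k)` if `σ = 1` and `P_j⁺(l)` if
`σ = -1`. -/
def creatLeg (χ : PreAssignment P T) (e : Edge T) : (i : Fin s) × Fin (P i).m :=
  if (χ e).1 = 1 then ⟨e.1.1, (χ e).2.1⟩ else ⟨e.1.2, (χ e).2.2⟩

/-- The set `𝒜(T)` of contraction assignments: no operator is contracted more than once. -/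
abbrev Assignment (P : Fin s → Interaction Ω) (T : LabeledTree s) :=
  {χ : PreAssignment P T // Function.Injective (annihLeg χ) ∧ Function.Injective (creatLeg χ)}

open scoped Classical in
instance : Fintype (Assignment P T) := inferInstance

/-- The position of the `k`-th operator of the `i`-th block, in the order of the blocks:
`∑_{r < i} m_{P_r} + k`. -/
def pos (P : Fin s → Interaction Ω) (x : (i : Fin s) × Fin (P i).m) : Fin (∑ i, (P i).m) :=
  finSigmaFinEquiv x

/-- The row of the Green's function matrix that is contracted at `e`. -/
def row (χ : Assignment P T) (e : Edge T) : Fin (∑ i, (P i).m) := pos P (annihLeg χ.1 e)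

/-- The column of the Green's function matrix that is contracted at `e`. -/
def col (χ : Assignment P T) (e : Edge T) : Fin (∑ i, (P i).m) := pos P (creatLeg χ.1 e)

/-- The sign `(-1)^{m(m+1)/2}` of an interaction term. -/
def interactionSign (Q : Interaction Ω) : ℤˣ := (-1) ^ (Q.m * (Q.m + 1) / 2)

/-- The sign `(-1)^{∑_{r<i} m_{P_r} + ∑_{r<j} m_{P_r} + k + l}` of `χ_{ij} = (σ, k, l)`. (The labels
`k, l` count from `0` here, which leaves the parity of `k + l` unchanged.) -/
def edgeSign (χ : Assignment P T) (e : Edge T) : ℤˣ :=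
  (-1) ^ ((∑ r ∈ Finset.Iio e.1.1, (P r).m) + (∑ r ∈ Finset.Iio e.1.2, (P r).m) +
    ((χ.1 e).2.1 : ℕ) + ((χ.1 e).2.2 : ℕ))

/-- The sign `(-1)^{inv(χ)}`, where `inv(χ)` is the number of pairs of tree edges whose contracted
rows and contracted columns are in opposite order. It is the sign of the bijection from contracted
rows to contracted columns. -/
def matchingSign (χ : Assignment P T) : ℤˣ :=
  (-1) ^ (Finset.univ.filter fun p : Edge T × Edge T =>
    row χ p.1 < row χ p.2 ∧ col χ p.2 < col χ p.1).card

/-- The sign `α_{T,χ}`. -/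
def treeSign (χ : Assignment P T) : ℤˣ :=
  (∏ i, interactionSign (P i)) * (∏ e, edgeSign χ e) * matchingSign χ

/-- The complement of the contracted rows. -/
def freeRows (χ : Assignment P T) : Finset (Fin (∑ i, (P i).m)) :=
  (Finset.univ.image (row χ))ᶜ

/-- The complement of the contracted columns. -/
def freeCols (χ : Assignment P T) : Finset (Fin (∑ i, (P i).m)) :=
  (Finset.univ.image (col χ))ᶜ

theorem card_freeCols (χ : Assignment P T) : (freeCols χ).card = (freeRows χ).card := by
  have h1 : Function.Injective (row χ) := fun a b hab =>
    χ.2.1 (finSigmaFinEquiv.injective hab)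
  have h2 : Function.Injective (col χ) := fun a b hab =>
    χ.2.2 (finSigmaFinEquiv.injective hab)
  simp only [freeCols, freeRows, Finset.card_compl, Finset.card_image_of_injective _ h1,
    Finset.card_image_of_injective _ h2]

end Trees

/-! ### Growing paths and interpolation weights

From here on the number of vertices is `s = n + 1` and the root is the least vertex `0`. -/

section Paths

variable {n : ℕ}

/-- `u` is the parent of `v` in the tree `T` rooted at `0`. -/
def IsParent (T : LabeledTree (n + 1)) (u v : Fin (n + 1)) : Prop :=
  T.1.Adj u v ∧ T.1.dist 0 v = T.1.dist 0 u + 1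

/-- The set `S(T)` of growing paths: orderings `ω(0), …, ω(n)` of the vertices that start at the root
and in which the parent of every vertex comes before the vertex. -/
abbrev GrowingPath (T : LabeledTree (n + 1)) :=
  {ω : Equiv.Perm (Fin (n + 1)) //
    ω 0 = 0 ∧ ∀ u v, IsParent T u v → ω.symm u < ω.symm v}

open scoped Classical in
instance (T : LabeledTree (n + 1)) : Fintype (GrowingPath T) := inferInstance

/-- The visited set `{ω(0), …, ω(i)}`. -/
def visited (ω : Equiv.Perm (Fin (n + 1))) (i : Fin n) : Finset (Fin (n + 1)) :=
  (Finset.Iic i.castSucc).image ω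

/-- The pair `(j, k)` crosses `X`: exactly one of `j` and `k` lies in `X`. -/
def Crosses (X : Finset (Fin (n + 1))) (j k : Fin (n + 1)) : Prop :=
  (j ∈ X ∧ k ∉ X) ∨ (k ∈ X ∧ j ∉ X)

instance (X : Finset (Fin (n + 1))) (j k : Fin (n + 1)) : Decidable (Crosses X j k) :=
  inferInstanceAs (Decidable (_ ∨ _))

/-- The number of edges of `T` that cross the visited set, which is the number of available choices
for the next vertex of the path. -/
def crossingNumber (T : LabeledTree (n + 1)) (ω : Equiv.Perm (Fin (n + 1))) (i : Fin n) : ℕ :=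
  (Finset.univ.filter fun e : Edge T => Crosses (visited ω i) e.1.1 e.1.2).card

/-- The density `p_{T,ω}(t) = ∏_i t_i^{b_i - 1}`. -/
def pathDensity (T : LabeledTree (n + 1)) (ω : Equiv.Perm (Fin (n + 1))) (t : Fin n → ℝ) : ℝ :=
  ∏ i, t i ^ (crossingNumber T ω i - 1)

/-- The weight `a(ω,t)_{jk}`, the product of the `t_i` over all `i` such that `(j, k)` crosses
`{ω(0), …, ω(i)}`. -/
def weight (ω : Equiv.Perm (Fin (n + 1))) (t : Fin n → ℝ) (j k : Fin (n + 1)) : ℝ :=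
  ∏ i with Crosses (visited ω i) j k, t i

end Paths

/-! ### Propagators and determinants -/

section Expansion

variable {Ω : Type*} [Fintype Ω] [LinearOrder Ω] {n : ℕ}

/-- The propagator `g_{τ_i,τ_j}(P_i,P_j,χ_{ij})` of the edge `(i, j)`. -/
def propagator (β : ℝ) (h : Matrix Ω Ω ℂ) {P : Fin (n + 1) → Interaction Ω} (τ : Fin (n + 1) → ℝ)
    {T : LabeledTree (n + 1)} (χ : Assignment P T) (e : Edge T) : ℂ :=
  if (χ.1 e).1 = 1 then
    green β h (τ e.1.2 - τ e.1.1) ((P e.1.2).minus (χ.1 e).2.2) ((P e.1.1).plus (χ.1 e).2.1)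
  else
    green β h (τ e.1.1 - τ e.1.2) ((P e.1.1).minus (χ.1 e).2.1) ((P e.1.2).plus (χ.1 e).2.2)

/-- The weighted Green's function matrix: the block `(i, j)` has the entries
`a(ω,t)_{ij} g_{τ_i-τ_j}(P_i⁻(k), P_j⁺(l))`, and the blocks are arranged in the order of `i` and
`j`. -/
def weightedGreen (β : ℝ) (h : Matrix Ω Ω ℂ) (P : Fin (n + 1) → Interaction Ω)
    (τ : Fin (n + 1) → ℝ) (ω : Equiv.Perm (Fin (n + 1))) (t : Fin n → ℝ) :
    Matrix (Fin (∑ i, (P i).m)) (Fin (∑ i, (P i).m)) ℂ :=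
  Matrix.of fun x y =>
    let r := finSigmaFinEquiv.symm x
    let c := finSigmaFinEquiv.symm y
    (weight ω t r.1 c.1 : ℂ) *
      green β h (τ r.1 - τ c.1) ((P r.1).minus r.2) ((P c.1).plus c.2)

/-- The submatrix `𝐆(T,χ,ω,t,{P_i,τ_i})` of the weighted Green's function matrix, obtained by deleting
the contracted rows and columns; the others keep their order. -/
def reducedGreen (β : ℝ) (h : Matrix Ω Ω ℂ) {P : Fin (n + 1) → Interaction Ω}
    (τ : Fin (n + 1) → ℝ) {T : LabeledTree (n + 1)} (χ : Assignment P T)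
    (ω : Equiv.Perm (Fin (n + 1))) (t : Fin n → ℝ) :
    Matrix (Fin (freeRows χ).card) (Fin (freeRows χ).card) ℂ :=
  (weightedGreen β h P τ ω t).submatrix
    ((freeRows χ).orderEmbOfFin rfl) ((freeCols χ).orderEmbOfFin (card_freeCols χ))

/-- The remainder
`h_τ(P_1,…,P_s,T,χ) = ∑_{ω ∈ S(T)} ∫_{[0,1]^{s-1}} p_{T,ω}(t) det 𝐆(T,χ,ω,t,{P_i,τ_i}) dt`. -/
def remainder (β : ℝ) (h : Matrix Ω Ω ℂ) {P : Fin (n + 1) → Interaction Ω} (τ : Fin (n + 1) → ℝ)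
    {T : LabeledTree (n + 1)} (χ : Assignment P T) : ℂ :=
  ∑ ω : GrowingPath T, ∫ t in Set.Icc (0 : Fin n → ℝ) 1,
    (pathDensity T ω.1 t : ℂ) * (reducedGreen β h τ χ ω.1 t).det

end Expansion

end TreeDet

end

noncomputable section

namespace TreeDet

/-! ### Canonical anticommutation relations -/

section CAR

variable {Ω : Type*} [LinearOrder Ω]

/-! Both sides are sums over permutations `σ` of the operator positions, with summand sign(σ) ∏ G(x,
σ x) for one matrix `G` of Green's functions, and it suffices that each `σ` carries the same
coefficient on both sides.

Wick's theorem makes every correlation a product of signs times a principal minor of `G`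
(`correlation_eq_det`). It comes from the KMS condition: a field `x` can be written `y + evolve h β
y`, so ⟨x A⟩ = ⟨yA + Ay⟩, and moving `y` through an odd product `A` leaves only scalar
anticommutators. The resulting recursion is also that of a Gaussian functional on an exterior
algebra, where letters anticommute exactly and reordering costs only signs.

A product of minors over the parts of a set partition keeps the permutations that never leave a
part. Hence the cumulant coefficients attach to `σ` the sum of (-1)^(|Π|-1) (|Π|-1)! over the
partitions not separating linked blocks. Counting colourings constant on components identifies this
sum as 1 if the link graph of `σ` is connected and 0 otherwise (`sum_partitions_respects`,
`connected_part_det`).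

On the tree side, a signed complementary minor collects the permutations containing the contracted
pairs (`sum_perm_extending`). For fixed `σ`, the `χ` contained in `σ` are the choices of one link of
`σ` for every tree edge (`card_assignments`). In the integrand, `t_i` has exponent `c_i - 1`, with
`c_i` the number of links of `σ` crossing the visited set, so the integral is ∏ 1/c_i
(`integral_pathDensity_mul_weights`). What remains is a probability: grow a vertex set from the root
by choosing a uniformly random crossing link at each step. The choices made record a tree and an
ordering compatible with it. If the links are connected the process never gets stuck, and the
probabilities sum to 1 (`sum_growing_paths`). If they are not, no tree has a link on every edge, and
the sum is 0. -/

/-- The Jordan–Wigner sign of the state `a` in the occupation set `S`. -/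
def jwSign (a : Ω) (S : Finset Ω) : ℂ := (-1) ^ (S.filter (· < a)).card

theorem jwSign_mul_self (a : Ω) (S : Finset Ω) : jwSign a S * jwSign a S = 1 := by
  rw [jwSign, ← mul_pow]; simp

theorem jwSign_insert {a b : Ω} {S : Finset Ω} (hb : b ∉ S) :
    jwSign a (insert b S) = (if b < a then -1 else 1) * jwSign a S := by
  unfold jwSign
  rw [Finset.filter_insert]
  split_ifs with h
  · rw [Finset.card_insert_of_notMem (by simp [hb]), pow_succ]; ring
  · ring

theorem jwSign_erase {a b : Ω} {S : Finset Ω} (hb : b ∈ S) :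
    jwSign a (S.erase b) = (if b < a then -1 else 1) * jwSign a S := by
  have h := jwSign_insert (a := a) (Finset.notMem_erase b S)
  rw [Finset.insert_erase hb] at h
  rw [h, ← mul_assoc]
  split_ifs <;> ring

theorem annih_apply (a : Ω) (S' S : Finset Ω) :
    annih a S' S = if a ∈ S ∧ S' = S.erase a then jwSign a S else 0 := rfl

theorem creat_apply (a : Ω) (S' S : Finset Ω) :
    creat a S' S = if a ∉ S ∧ S' = insert a S then jwSign a S else 0 := by
  have h : (a ∈ S' ∧ S = S'.erase a) ↔ (a ∉ S ∧ S' = insert a S) := by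
    constructor
    · rintro ⟨h, rfl⟩; simp [h]
    · rintro ⟨h, rfl⟩; simp [h]
  rw [creat, Matrix.conjTranspose_apply, annih_apply]
  by_cases h' : a ∉ S ∧ S' = insert a S
  · rw [if_pos h', if_pos (h.2 h'), h'.2, jwSign_insert h'.1]
    simp [jwSign]
  · rw [if_neg h', if_neg (fun k => h' (h.1 k))]; simp

variable [Fintype Ω]

theorem mul_annih_apply (A : FockOp Ω) (b : Ω) (S' S : Finset Ω) :
    (A * annih b) S' S = if b ∈ S then A S' (S.erase b) * jwSign b S else 0 := by
  rw [Matrix.mul_apply]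
  simp only [annih_apply]
  split_ifs with h
  · rw [Finset.sum_eq_single (S.erase b)] <;> simp +contextual [h]
  · simp [h]

theorem mul_creat_apply (A : FockOp Ω) (b : Ω) (S' S : Finset Ω) :
    (A * creat b) S' S = if b ∉ S then A S' (insert b S) * jwSign b S else 0 := by
  rw [Matrix.mul_apply]
  simp only [creat_apply]
  split_ifs with h
  · rw [Finset.sum_eq_single (insert b S)] <;> simp +contextual [h]
  · simp [h]

theorem annih_anticomm_annih (a b : Ω) : annih a * annih b + annih b * annih a = 0 := by
  ext S' S
  rw [Matrix.add_apply, mul_annih_apply, mul_annih_apply, annih_apply, annih_apply]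
  rcases lt_trichotomy a b with h | rfl | h
  · by_cases ha : a ∈ S <;> by_cases hb : b ∈ S <;>
      simp [ha, hb, h.ne, h.ne', jwSign_erase, Finset.erase_right_comm (a := a) (b := b), h, h.not_gt]
    split_ifs <;> ring
  · simp
  · by_cases ha : a ∈ S <;> by_cases hb : b ∈ S <;>
      simp [ha, hb, h.ne, h.ne', jwSign_erase, Finset.erase_right_comm (a := a) (b := b), h, h.not_gt]
    split_ifs <;> ring

theorem creat_anticomm_creat (a b : Ω) : creat a * creat b + creat b * creat a = 0 := by
  have h := congrArg Matrix.conjTranspose (annih_anticomm_annih b a)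
  simpa [Matrix.conjTranspose_add, Matrix.conjTranspose_mul, creat] using h

theorem annih_anticomm_creat (a b : Ω) :
    annih a * creat b + creat b * annih a = if a = b then 1 else 0 := by
  ext S' S
  rw [Matrix.add_apply, mul_annih_apply, mul_creat_apply, annih_apply, creat_apply]
  by_cases hab : a = b
  · subst hab
    by_cases ha : a ∈ S
    · simp [ha, jwSign_erase, Matrix.one_apply, jwSign_mul_self]
    · simp [ha, jwSign_insert, Matrix.one_apply, jwSign_mul_self]
  · rw [if_neg hab]
    by_cases ha : a ∈ S <;> by_cases hb : b ∈ S <;>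
      simp [ha, hb, hab, Ne.symm hab]
    rw [Finset.erase_insert_of_ne (Ne.symm hab)]
    split_ifs
    · rw [jwSign_insert hb, jwSign_erase ha]
      rcases lt_or_gt_of_ne hab with h | h <;> simp [h, h.not_gt] <;> ring
    · simp

end CAR

/-! ### Invariance of a subspace under imaginary-time evolution -/

section Evolution

open NormedSpace

/-- Left multiplication by `H` and right multiplication by `-H` commute and their sum is the
commutator with `H`, so the conjugation is the exponential of that commutator. The partial sums of
its series stay in `W`, which is closed by finite dimension. -/
theorem exp_conj_mem {A : Type*} [NormedRing A] [NormedAlgebra ℂ A] [FiniteDimensional ℂ A]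
    (H : A) (W : Submodule ℂ A) (hW : ∀ w ∈ W, H * w - w * H ∈ W)
    {w : A} (hw : w ∈ W) : exp H * w * exp (-H) ∈ W := by
  have : CompleteSpace A := FiniteDimensional.complete ℂ A
  let _ : NormedAlgebra ℚ (A →L[ℂ] A) := NormedAlgebra.restrictScalars ℚ ℂ _
  let L : A →L[ℂ] A := ContinuousLinearMap.mul ℂ _ H
  let R : A →L[ℂ] A := (ContinuousLinearMap.mul ℂ _).flip (-H)
  have hLR : Commute L R := by
    ext1 x; exact (mul_assoc H x (-H)).symm
  have hL : ∀ k : ℕ, ∀ x, (L ^ k) x = H ^ k * x := by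
    intro k; induction k with
    | zero => simp
    | succ k ih => intro x; rw [pow_succ', mul_apply_eq_comp, ih, pow_succ', mul_assoc]; rfl
  have hR : ∀ k : ℕ, ∀ x, (R ^ k) x = x * (-H) ^ k := by
    intro k; induction k with
    | zero => simp
    | succ k ih => intro x; rw [pow_succ', mul_apply_eq_comp, ih, pow_succ, ← mul_assoc]; rfl
  have key : ∀ (B : A →L[ℂ] A) x,
      HasSum (fun k : ℕ => (k.factorial⁻¹ : ℂ) • (B ^ k) x) (exp B x) := by
    intro B x
    have h := exp_series_hasSum_exp' (𝕂 := ℂ) B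
    exact h.mapL ((ContinuousLinearMap.apply ℂ A) x)
  have keyM : ∀ x : A, HasSum (fun k : ℕ => (k.factorial⁻¹ : ℂ) • x ^ k) (exp x) :=
    fun x => exp_series_hasSum_exp' (𝕂 := ℂ) x
  have hLe : ∀ x, exp L x = exp H * x := fun x => by
    refine (key L x).unique ?_
    simp only [hL]
    convert! (keyM H).mul_right x using 2 with k
    rw [smul_mul_assoc]
  have hRe : ∀ x, exp R x = x * exp (-H) := fun x => by
    refine (key R x).unique ?_
    simp only [hR]
    convert! (keyM (-H)).mul_left x using 2 with k
    rw [mul_smul_comm]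
  have h1 : exp (L + R) w = exp H * w * exp (-H) := by
    rw [exp_add_of_commute hLR, mul_apply_eq_comp, hRe, hLe, mul_assoc]
  rw [← h1]
  have hpow : ∀ k : ℕ, ((L + R) ^ k) w ∈ W := by
    intro k; induction k with
    | zero => simpa
    | succ k ih =>
      rw [pow_succ', mul_apply_eq_comp]
      have := hW _ ih
      simpa [L, R, sub_eq_add_neg] using this
  have hcl : IsClosed (W : Set A) := W.closed_of_finiteDimensional
  exact hcl.mem_of_tendsto (key (L + R) w) (Filter.Eventually.of_forall fun s =>
    W.sum_mem fun k _ => W.smul_mem _ (hpow k))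

open scoped Matrix.Norms.Operator in
theorem matrix_exp_conj_mem {m : Type*} [Fintype m] [DecidableEq m] (H : Matrix m m ℂ)
    (W : Submodule ℂ (Matrix m m ℂ)) (hW : ∀ w ∈ W, H * w - w * H ∈ W)
    {w : Matrix m m ℂ} (hw : w ∈ W) : exp H * w * exp (-H) ∈ W :=
  exp_conj_mem H W hW hw

end Evolution

/-! ### Free evolution and the thermal state -/

section Thermal

open NormedSpace
open scoped ComplexOrder

variable {Ω : Type*} [LinearOrder Ω]

/-- The span of the annihilation operators. -/
def annihSpan (Ω : Type*) [LinearOrder Ω] : Submodule ℂ (FockOp Ω) :=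
  Submodule.span ℂ (Set.range annih)

/-- The span of the creation operators. -/
def creatSpan (Ω : Type*) [LinearOrder Ω] : Submodule ℂ (FockOp Ω) :=
  Submodule.span ℂ (Set.range creat)

theorem annih_mem (a : Ω) : annih a ∈ annihSpan Ω := Submodule.subset_span ⟨a, rfl⟩

theorem creat_mem (a : Ω) : creat a ∈ creatSpan Ω := Submodule.subset_span ⟨a, rfl⟩

variable [Fintype Ω]

theorem commutator_freeHam_mem (h : Matrix Ω Ω ℂ) (W : Submodule ℂ (FockOp Ω)) {w : FockOp Ω}
    (hw : ∀ a b, creat a * annih b * w - w * (creat a * annih b) ∈ W) :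
    freeHam h * w - w * freeHam h ∈ W := by
  have : freeHam h * w - w * freeHam h =
      ∑ a, ∑ b, h a b • (creat a * annih b * w - w * (creat a * annih b)) := by
    simp only [freeHam, Finset.sum_mul, Finset.mul_sum, smul_sub, Finset.sum_sub_distrib,
      smul_mul_assoc, mul_smul_comm]
  rw [this]
  exact W.sum_mem fun a _ => W.sum_mem fun b _ => W.smul_mem _ (hw a b)

/-- A subspace of operators that is invariant under the commutator with the free Hamiltonian. -/
def AdInvariant (h : Matrix Ω Ω ℂ) (W : Submodule ℂ (FockOp Ω)) : Prop :=
  ∀ w ∈ W, freeHam h * w - w * freeHam h ∈ W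

theorem adInvariant_span (h : Matrix Ω Ω ℂ) (f : Ω → FockOp Ω)
    (hf : ∀ a b c, creat a * annih b * f c - f c * (creat a * annih b) ∈
      Submodule.span ℂ (Set.range f)) :
    AdInvariant h (Submodule.span ℂ (Set.range f)) := by
  intro w hw
  induction hw using Submodule.span_induction with
  | mem x hx =>
    obtain ⟨c, rfl⟩ := hx
    exact commutator_freeHam_mem h _ fun a b => hf a b c
  | zero => simp
  | add x y _ _ hx hy =>
    have := Submodule.add_mem _ hx hy
    convert this using 1; noncomm_ring
  | smul r x _ hx =>
    have := Submodule.smul_mem _ r hx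
    rwa [smul_sub, ← mul_smul_comm, ← smul_mul_assoc] at this

/-- The commutator of a product of two fields with a third is linear in the fields by the
anticommutation relations. Invariance makes the evolved operators one-particle operators again. -/
theorem adInvariant_annihSpan (h : Matrix Ω Ω ℂ) : AdInvariant h (annihSpan Ω) := by
  refine adInvariant_span h _ fun a b c => ?_
  have h1 := annih_anticomm_creat c a
  have h2 := annih_anticomm_annih c b
  have e1 : annih c * creat a = (if c = a then 1 else 0) - creat a * annih c := by
    rw [← h1]; abel
  have e2 : annih c * annih b = - (annih b * annih c) := by rw [eq_neg_iff_add_eq_zero, h2]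
  have : creat a * annih b * annih c - annih c * (creat a * annih b) =
      - ((if c = a then 1 else 0 : FockOp Ω) * annih b) := by
    rw [← mul_assoc, e1, sub_mul, mul_assoc (creat a) (annih c), e2]; noncomm_ring
  rw [this]
  refine Submodule.neg_mem _ ?_
  split_ifs
  · rw [one_mul]; exact annih_mem b
  · simp

theorem adInvariant_creatSpan (h : Matrix Ω Ω ℂ) : AdInvariant h (creatSpan Ω) := by
  refine adInvariant_span h _ fun a b c => ?_
  have h1 := annih_anticomm_creat b c
  have h2 := creat_anticomm_creat c a
  have e1 : annih b * creat c = (if b = c then 1 else 0) - creat c * annih b := by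
    rw [← h1]; abel
  have e2 : creat c * creat a = - (creat a * creat c) := by rw [eq_neg_iff_add_eq_zero, h2]
  have : creat a * annih b * creat c - creat c * (creat a * annih b) =
      creat a * (if b = c then 1 else 0 : FockOp Ω) := by
    rw [← mul_assoc (creat c), e2, mul_assoc, e1]; noncomm_ring
  rw [this]
  split_ifs
  · rw [mul_one]; exact creat_mem a
  · simp

theorem anticomm_scalar_span {S T : Set (FockOp Ω)}
    (hST : ∀ x ∈ S, ∀ y ∈ T, ∃ d : ℂ, x * y + y * x = d • 1) {x y : FockOp Ω}
    (hx : x ∈ Submodule.span ℂ S) (hy : y ∈ Submodule.span ℂ T) :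
    ∃ d : ℂ, x * y + y * x = d • 1 := by
  induction hx, hy using Submodule.span_induction₂ with
  | mem_mem x y hx hy => exact hST x hx y hy
  | zero_left y _ => exact ⟨0, by simp⟩
  | zero_right x _ => exact ⟨0, by simp⟩
  | add_left x y z _ _ _ h1 h2 =>
    obtain ⟨d, hd⟩ := h1; obtain ⟨e, he⟩ := h2
    exact ⟨d + e, by rw [add_smul, ← hd, ← he]; noncomm_ring⟩
  | add_right x y z _ _ _ h1 h2 =>
    obtain ⟨d, hd⟩ := h1; obtain ⟨e, he⟩ := h2
    exact ⟨d + e, by rw [add_smul, ← hd, ← he]; noncomm_ring⟩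
  | smul_left r x y _ _ h1 =>
    obtain ⟨d, hd⟩ := h1
    exact ⟨r * d, by rw [mul_smul, ← hd, smul_add, smul_mul_assoc, mul_smul_comm]⟩
  | smul_right r x y _ _ h1 =>
    obtain ⟨d, hd⟩ := h1
    exact ⟨r * d, by rw [mul_smul, ← hd, smul_add, smul_mul_assoc, mul_smul_comm]⟩

theorem anticomm_eq_zero_span {f : Ω → FockOp Ω} (hf : ∀ a b, f a * f b + f b * f a = 0)
    {x y : FockOp Ω} (hx : x ∈ Submodule.span ℂ (Set.range f))
    (hy : y ∈ Submodule.span ℂ (Set.range f)) : x * y + y * x = 0 := by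
  induction hx, hy using Submodule.span_induction₂ with
  | mem_mem x y hx hy =>
    obtain ⟨a, rfl⟩ := hx
    obtain ⟨b, rfl⟩ := hy
    exact hf a b
  | zero_left y _ => simp
  | zero_right x _ => simp
  | add_left x y z _ _ _ h1 h2 =>
    rw [add_mul, mul_add, add_add_add_comm, h1, h2, add_zero]
  | add_right x y z _ _ _ h1 h2 =>
    rw [add_mul, mul_add, add_add_add_comm, h1, h2, add_zero]
  | smul_left r x y _ _ h1 => rw [smul_mul_assoc, mul_smul_comm, ← smul_add, h1, smul_zero]
  | smul_right r x y _ _ h1 => rw [smul_mul_assoc, mul_smul_comm, ← smul_add, h1, smul_zero]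

/-- The one-particle operators: those linear in the annihilation operators and those linear in the
creation operators. -/
def IsField (x : FockOp Ω) : Prop := x ∈ annihSpan Ω ∨ x ∈ creatSpan Ω

theorem IsField.anticomm {x y : FockOp Ω} (hx : IsField x) (hy : IsField y) :
    ∃ d : ℂ, x * y + y * x = d • 1 := by
  have mixed : ∀ {x y : FockOp Ω}, x ∈ annihSpan Ω → y ∈ creatSpan Ω →
      ∃ d : ℂ, x * y + y * x = d • 1 := fun hx hy => by
    refine anticomm_scalar_span ?_ hx hy
    rintro _ ⟨a, rfl⟩ _ ⟨b, rfl⟩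
    exact ⟨if a = b then 1 else 0, by rw [annih_anticomm_creat]; split_ifs <;> simp⟩
  rcases hx with hx | hx <;> rcases hy with hy | hy
  · exact ⟨0, by rw [zero_smul]; exact anticomm_eq_zero_span annih_anticomm_annih hx hy⟩
  · exact mixed hx hy
  · obtain ⟨d, hd⟩ := mixed hy hx
    exact ⟨d, by rw [← hd, add_comm]⟩
  · exact ⟨0, by rw [zero_smul]; exact anticomm_eq_zero_span creat_anticomm_creat hx hy⟩

/-! ### Imaginary-time evolution and the KMS condition -/

theorem exp_neg_mul_exp {m : Type*} [Fintype m] [DecidableEq m] (A : Matrix m m ℂ) :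
    exp (-A) * exp A = 1 := by
  rw [← Matrix.exp_add_of_commute _ _ (Commute.neg_left (Commute.refl A)), neg_add_cancel,
    NormedSpace.exp_zero]

theorem exp_mul_exp_neg {m : Type*} [Fintype m] [DecidableEq m] (A : Matrix m m ℂ) :
    exp A * exp (-A) = 1 := by
  simpa using exp_neg_mul_exp (-A)

theorem evolve_mem {h : Matrix Ω Ω ℂ} {W : Submodule ℂ (FockOp Ω)} (hW : AdInvariant h W) (t : ℝ)
    {w : FockOp Ω} (hw : w ∈ W) : evolve h t w ∈ W := by
  refine matrix_exp_conj_mem _ W (fun w hw => ?_) hw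
  have := W.smul_mem (t : ℂ) (hW w hw)
  rwa [smul_mul_assoc, mul_smul_comm, ← smul_sub]

theorem IsField.evolve {x : FockOp Ω} (hx : IsField x) (h : Matrix Ω Ω ℂ) (t : ℝ) :
    IsField (evolve h t x) :=
  hx.imp (evolve_mem (adInvariant_annihSpan h) t) (evolve_mem (adInvariant_creatSpan h) t)

theorem evolve_mul (h : Matrix Ω Ω ℂ) (t : ℝ) (A B : FockOp Ω) :
    evolve h t (A * B) = evolve h t A * evolve h t B := by
  simp only [evolve]
  calc _ = exp ((t : ℂ) • freeHam h) * A * 1 * B * exp (-((t : ℂ) • freeHam h)) := by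
        simp only [mul_one, mul_assoc]
    _ = _ := by rw [← exp_neg_mul_exp ((t : ℂ) • freeHam h)]; simp only [mul_assoc]

theorem evolve_one (h : Matrix Ω Ω ℂ) (t : ℝ) : evolve h t 1 = 1 := by
  rw [evolve, mul_one, exp_mul_exp_neg]

theorem evolve_list_prod (h : Matrix Ω Ω ℂ) (t : ℝ) (l : List (FockOp Ω)) :
    evolve h t l.prod = (l.map (evolve h t)).prod := by
  induction l with
  | nil => simp [evolve_one]
  | cons a l ih => simp [evolve_mul, ih]

theorem evolve_evolve (h : Matrix Ω Ω ℂ) (s t : ℝ) (A : FockOp Ω) :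
    evolve h s (evolve h t A) = evolve h (s + t) A := by
  have c : Commute ((s : ℂ) • freeHam h) ((t : ℂ) • freeHam h) :=
    ((Commute.refl _).smul_left _).smul_right _
  simp only [evolve]
  rw [Complex.ofReal_add, add_smul, neg_add, Matrix.exp_add_of_commute _ _ c,
    add_comm (-((s : ℂ) • freeHam h)),
    Matrix.exp_add_of_commute _ _ (c.symm.neg_left.neg_right)]
  simp only [mul_assoc]

theorem evolve_add (h : Matrix Ω Ω ℂ) (t : ℝ) (A B : FockOp Ω) :
    evolve h t (A + B) = evolve h t A + evolve h t B := by
  simp only [evolve, mul_add, add_mul]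

theorem evolve_smul (h : Matrix Ω Ω ℂ) (t : ℝ) (c : ℂ) (A : FockOp Ω) :
    evolve h t (c • A) = c • evolve h t A := by
  simp only [evolve, mul_smul_comm, smul_mul_assoc]

theorem thermal_add (β : ℝ) (h : Matrix Ω Ω ℂ) (A B : FockOp Ω) :
    thermal β h (A + B) = thermal β h A + thermal β h B := by
  simp only [thermal, add_mul, Matrix.trace_add, add_div]

theorem thermal_smul (β : ℝ) (h : Matrix Ω Ω ℂ) (c : ℂ) (A : FockOp Ω) :
    thermal β h (c • A) = c * thermal β h A := by
  simp only [thermal, smul_mul_assoc, Matrix.trace_smul, smul_eq_mul, mul_div_assoc]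

/-- The thermal expectation as a linear functional. -/
def thermalLin (β : ℝ) (h : Matrix Ω Ω ℂ) : FockOp Ω →ₗ[ℂ] ℂ where
  toFun := thermal β h
  map_add' := thermal_add β h
  map_smul' := thermal_smul β h

/-- The Kubo–Martin–Schwinger condition. -/
theorem thermal_evolve_mul (β : ℝ) (h : Matrix Ω Ω ℂ) (y A : FockOp Ω) :
    thermal β h (evolve h β y * A) = thermal β h (A * y) := by
  have e := exp_neg_mul_exp ((β : ℂ) • freeHam h)
  simp only [thermal, evolve]
  congr 1
  set E := exp ((β : ℂ) • freeHam h)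
  set R := exp (-((β : ℂ) • freeHam h))
  calc (E * y * R * A * R).trace = (E * (y * R * A * R)).trace := by simp only [mul_assoc]
    _ = (y * R * A * (R * E)).trace := by rw [Matrix.trace_mul_comm]; simp only [mul_assoc]
    _ = (y * (R * A)).trace := by rw [e, mul_one, mul_assoc]
    _ = (A * y * R).trace := by
      rw [← mul_assoc, Matrix.trace_mul_comm, mul_assoc]

/-- Invariance of the thermal state under the free evolution. -/
theorem thermal_evolve (β : ℝ) (h : Matrix Ω Ω ℂ) (t : ℝ) (A : FockOp Ω) :
    thermal β h (evolve h t A) = thermal β h A := by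
  have e := exp_neg_mul_exp ((t : ℂ) • freeHam h)
  have c : Commute (exp (-((t : ℂ) • freeHam h))) (exp (-((β : ℂ) • freeHam h))) := by
    have hc : Commute (-((t : ℂ) • freeHam h)) (-((β : ℂ) • freeHam h)) :=
      (((Commute.refl _).smul_left _).smul_right _).neg_left.neg_right
    rw [Commute, SemiconjBy, ← Matrix.exp_add_of_commute _ _ hc,
      ← Matrix.exp_add_of_commute _ _ hc.symm, add_comm]
  simp only [thermal, evolve]
  congr 1
  rw [mul_assoc, c.eq, mul_assoc, Matrix.trace_mul_comm]
  rw [mul_assoc, mul_assoc, e, mul_one]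

/-! ### Positivity of the Boltzmann factor -/

theorem freeHam_isHermitian {h : Matrix Ω Ω ℂ} (hh : h.IsHermitian) :
    (freeHam h).IsHermitian := by
  rw [Matrix.IsHermitian, freeHam, Matrix.conjTranspose_sum]
  simp only [Matrix.conjTranspose_sum, Matrix.conjTranspose_smul, Matrix.conjTranspose_mul, creat,
    Matrix.conjTranspose_conjTranspose]
  rw [Finset.sum_comm]
  refine Finset.sum_congr rfl fun a _ => Finset.sum_congr rfl fun b _ => ?_
  rw [hh.apply]

theorem exists_exp_eq_conjTranspose_mul_self (β : ℝ) {h : Matrix Ω Ω ℂ} (hh : h.IsHermitian) :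
    ∃ S : FockOp Ω, IsUnit S ∧ exp (-((β : ℂ) • freeHam h)) = S.conjTranspose * S := by
  refine ⟨exp ((-(β / 2) : ℂ) • freeHam h), Matrix.isUnit_exp _, ?_⟩
  have hS : (exp ((-(β / 2) : ℂ) • freeHam h)).IsHermitian := by
    refine Matrix.IsHermitian.exp ?_
    rw [Matrix.IsHermitian, Matrix.conjTranspose_smul, freeHam_isHermitian hh]
    congr 1
    simp
  rw [hS.eq, ← Matrix.exp_add_of_commute _ _ (Commute.refl _), ← add_smul, ← neg_smul]
  congr 2
  ring

theorem thermal_one (β : ℝ) {h : Matrix Ω Ω ℂ} (hh : h.IsHermitian) : thermal β h 1 = 1 := by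
  obtain ⟨S, hS, e⟩ := exists_exp_eq_conjTranspose_mul_self β hh
  rw [thermal, one_mul, div_self]
  rw [e]
  intro h0
  rw [Matrix.trace_conjTranspose_mul_self_eq_zero_iff] at h0
  rw [h0] at hS
  exact not_isUnit_zero hS

/-- With R = S*S the Boltzmann factor, the hypothesis says Ry + yR = 0. Multiplying by y* and taking
the trace gives ‖Sy‖² + ‖yS*‖² = 0 in the Hilbert–Schmidt norm, and `S` is invertible. -/
theorem eq_zero_of_add_evolve_eq_zero (β : ℝ) {h : Matrix Ω Ω ℂ} (hh : h.IsHermitian)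
    {y : FockOp Ω} (hy : y + evolve h β y = 0) : y = 0 := by
  obtain ⟨S, hS, e⟩ := exists_exp_eq_conjTranspose_mul_self β hh
  have e1 := exp_neg_mul_exp ((β : ℂ) • freeHam h)
  rw [evolve] at hy
  rw [e] at hy e1
  have h1 : S.conjTranspose * S * y + y * (S.conjTranspose * S) = 0 := by
    have := congrArg (S.conjTranspose * S * ·) hy
    simp only [mul_add, mul_zero] at this
    rwa [← mul_assoc, ← mul_assoc (S.conjTranspose * S), e1, one_mul] at this
  have h2 : ((S * y).conjTranspose * (S * y)).trace +
      ((y * S.conjTranspose).conjTranspose * (y * S.conjTranspose)).trace = 0 := by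
    have := congrArg (fun z => (y.conjTranspose * z).trace) h1
    simp only [mul_add, mul_zero, Matrix.trace_add, Matrix.trace_zero] at this
    rw [← this]
    congr 1
    · rw [Matrix.conjTranspose_mul]; simp only [mul_assoc]
    · rw [Matrix.conjTranspose_mul, Matrix.conjTranspose_conjTranspose]
      rw [mul_assoc S, Matrix.trace_mul_comm S]; simp only [mul_assoc]
  have p1 := (Matrix.posSemidef_conjTranspose_mul_self (S * y)).trace_nonneg
  have p2 := (Matrix.posSemidef_conjTranspose_mul_self (y * S.conjTranspose)).trace_nonneg
  have h3 := ((add_eq_zero_iff_of_nonneg p1 p2).1 h2).1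
  rw [Matrix.trace_conjTranspose_mul_self_eq_zero_iff] at h3
  obtain ⟨u, rfl⟩ := hS
  have := congrArg ((↑u⁻¹ : FockOp Ω) * ·) h3
  simpa using this

/-- An injective endomorphism of a finite-dimensional space is surjective. This inverts 1 +
(evolution by β) without diagonalising `h`. -/
theorem exists_add_evolve_eq (β : ℝ) {h : Matrix Ω Ω ℂ} (hh : h.IsHermitian)
    {W : Submodule ℂ (FockOp Ω)} (hW : AdInvariant h W) {x : FockOp Ω} (hx : x ∈ W) :
    ∃ y ∈ W, y + evolve h β y = x := by
  let f : W →ₗ[ℂ] W :=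
    { toFun := fun y => ⟨y + evolve h β y, W.add_mem y.2 (evolve_mem hW β y.2)⟩
      map_add' := fun y z => by
        ext1; simp only [Submodule.coe_add, evolve_add]; abel
      map_smul' := fun c y => by
        ext1; simp only [Submodule.coe_smul, evolve_smul, smul_add, RingHom.id_apply] }
  have hf : Function.Injective f := by
    rw [← LinearMap.ker_eq_bot, LinearMap.ker_eq_bot']
    intro y hy
    ext1
    exact eq_zero_of_add_evolve_eq_zero β hh (congrArg Subtype.val hy)
  obtain ⟨y, hy⟩ := LinearMap.injective_iff_surjective.1 hf ⟨x, hx⟩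
  exact ⟨y, y.2, congrArg Subtype.val hy⟩

/-! ### The Wick recursion -/

theorem mul_ofFn_prod {A : Type*} [Ring A] [Algebra ℂ A] {N : ℕ} (y : A) (c : Fin (N + 1) → A)
    (d : Fin (N + 1) → ℂ) (hd : ∀ j, y * c j + c j * y = d j • 1) :
    y * (List.ofFn c).prod =
      ∑ j : Fin (N + 1), ((-1) ^ (j : ℕ) * d j) • (List.ofFn (fun i => c (j.succAbove i))).prod +
        (-1 : ℂ) ^ (N + 1) • ((List.ofFn c).prod * y) := by
  induction N with
  | zero =>
    have := hd 0
    simp [← this]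
  | succ N ih =>
    have h0 : y * c 0 = d 0 • 1 - c 0 * y := by rw [← hd 0]; abel
    have hp : ∀ j : Fin (N + 1), (List.ofFn (fun i => c (j.succ.succAbove i))).prod =
        c 0 * (List.ofFn (fun i => c (j.succAbove i).succ)).prod := fun j => by
      rw [List.ofFn_succ, List.prod_cons]
      simp only [Fin.succ_succAbove_zero, Fin.succ_succAbove_succ]
    rw [List.ofFn_succ, List.prod_cons, ← mul_assoc, h0, sub_mul, mul_assoc,
      ih (fun i => c i.succ) (fun i => d i.succ) (fun j => hd _), Fin.sum_univ_succ (n := N + 1)]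
    simp only [hp, mul_add, Finset.mul_sum, mul_smul_comm, Fin.succAbove_zero,
      Fin.val_succ, pow_succ, Fin.val_zero, pow_zero, one_mul, smul_mul_assoc, mul_neg, mul_one,
      neg_mul, neg_smul, Finset.sum_neg_distrib, neg_neg, ← mul_assoc]
    abel

/-- The Wick recursion for the thermal state. -/
theorem thermal_mul_ofFn_prod (β : ℝ) {h : Matrix Ω Ω ℂ} (hh : h.IsHermitian) {N : ℕ}
    (hN : Even N) {x : FockOp Ω} (hx : IsField x) (c : Fin (N + 1) → FockOp Ω)
    (hc : ∀ j, IsField (c j)) :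
    thermal β h (x * (List.ofFn c).prod) =
      ∑ j : Fin (N + 1), (-1) ^ (j : ℕ) * thermal β h (x * c j) *
        thermal β h (List.ofFn (fun i => c (j.succAbove i))).prod := by
  obtain ⟨y, hy, rfl⟩ : ∃ y, IsField y ∧ y + evolve h β y = x := by
    rcases hx with hx | hx
    · obtain ⟨y, hy, e⟩ := exists_add_evolve_eq β hh (adInvariant_annihSpan h) hx
      exact ⟨y, Or.inl hy, e⟩
    · obtain ⟨y, hy, e⟩ := exists_add_evolve_eq β hh (adInvariant_creatSpan h) hx
      exact ⟨y, Or.inr hy, e⟩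
  -- The scalars `d j` are anticommutators with `y`; by `key` and the normalisation of the state
  -- they equal the two-point functions ⟨x c_j⟩.
  choose d hd using fun j => hy.anticomm (hc j)
  have key : ∀ A, thermal β h ((y + evolve h β y) * A) = thermal β h (y * A + A * y) := by
    intro A
    rw [add_mul, thermal_add, thermal_add, thermal_evolve_mul]
  simp only [key, hd, thermal_smul, thermal_one β hh, mul_one]
  have h1 := mul_ofFn_prod y c d hd
  -- The product has odd length, so the term with `y` moved to the far right has sign -1 and cancels
  -- against the second half of the anticommutator.
  rw [pow_succ, hN.neg_one_pow, one_mul, neg_smul, one_smul] at h1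
  rw [h1, neg_add_cancel_right]
  change thermalLin β h _ = _
  rw [map_sum]
  refine Finset.sum_congr rfl fun j _ => ?_
  rw [map_smul, smul_eq_mul]
  rfl

/-- The same splitting turns ⟨xy⟩ into the expectation of an anticommutator inside `W`. It makes the
diagonal blocks of the contraction matrix vanish. -/
theorem thermal_mul_eq_zero (β : ℝ) {h : Matrix Ω Ω ℂ} (hh : h.IsHermitian)
    {W : Submodule ℂ (FockOp Ω)} (hW : AdInvariant h W)
    (hW' : ∀ x ∈ W, ∀ y ∈ W, x * y + y * x = 0) {x y : FockOp Ω} (hx : x ∈ W) (hy : y ∈ W) :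
    thermal β h (x * y) = 0 := by
  obtain ⟨z, hz, rfl⟩ := exists_add_evolve_eq β hh hW hx
  rw [add_mul, thermal_add, thermal_evolve_mul, ← thermal_add, hW' z hz y hy]
  exact (thermalLin β h).map_zero

theorem thermal_annihSpan_mul (β : ℝ) {h : Matrix Ω Ω ℂ} (hh : h.IsHermitian) {x y : FockOp Ω}
    (hx : x ∈ annihSpan Ω) (hy : y ∈ annihSpan Ω) : thermal β h (x * y) = 0 :=
  thermal_mul_eq_zero β hh (adInvariant_annihSpan h)
    (fun _ hx _ hy => anticomm_eq_zero_span annih_anticomm_annih hx hy) hx hy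

theorem thermal_creatSpan_mul (β : ℝ) {h : Matrix Ω Ω ℂ} (hh : h.IsHermitian) {x y : FockOp Ω}
    (hx : x ∈ creatSpan Ω) (hy : y ∈ creatSpan Ω) : thermal β h (x * y) = 0 :=
  thermal_mul_eq_zero β hh (adInvariant_creatSpan h)
    (fun _ hx _ hy => anticomm_eq_zero_span creat_anticomm_creat hx hy) hx hy

end Thermal

/-! ### The Gaussian functional on the exterior algebra -/

section Gaussian

open ExteriorAlgebra

/-- Contraction is an antiderivation; the alternating sum has the shape of the Wick recursion. -/
theorem contractLeft_ofFn_ι_prod {V : Type*} [AddCommGroup V] [Module ℂ V]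
    (d : Module.Dual ℂ V) {N : ℕ} (v : Fin (N + 1) → V) :
    CliffordAlgebra.contractLeft (Q := (0 : QuadraticForm ℂ V)) d
        (List.ofFn fun i => ι ℂ (v i)).prod =
      ∑ j : Fin (N + 1), ((-1) ^ (j : ℕ) * d (v j)) •
        (List.ofFn fun i => ι ℂ (v (j.succAbove i))).prod := by
  induction N with
  | zero => simp [CliffordAlgebra.contractLeft_ι, ι, Algebra.algebraMap_eq_smul_one]
  | succ N ih =>
    have hp : ∀ j : Fin (N + 1), (List.ofFn (fun i => ι ℂ (v (j.succ.succAbove i)))).prod =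
        ι ℂ (v 0) * (List.ofFn (fun i => ι ℂ (v (j.succAbove i).succ))).prod := fun j => by
      rw [List.ofFn_succ, List.prod_cons]
      simp only [Fin.succ_succAbove_zero, Fin.succ_succAbove_succ]
    rw [List.ofFn_succ, List.prod_cons, ι, CliffordAlgebra.contractLeft_ι_mul,
      Fin.sum_univ_succ (n := N + 1)]
    rw [← ι, ih (fun i => v i.succ)]
    simp only [hp, Finset.mul_sum, mul_smul_comm, Fin.succAbove_zero,
      Fin.val_succ, pow_succ, Fin.val_zero, pow_zero, one_mul, mul_neg, mul_one,
      neg_mul, neg_smul, Finset.sum_neg_distrib, sub_eq_add_neg]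

variable {X : Type*}

/-- The antisymmetric matrix of contractions: `inl x` stands for an annihilation operator, `inr y`
for a creation operator, and `G x y` is their contraction. -/
def contractionMatrix (G : Matrix X X ℂ) : Matrix (X ⊕ X) (X ⊕ X) ℂ :=
  Matrix.fromBlocks 0 G (-G.transpose) 0

theorem contractionMatrix_transpose (G : Matrix X X ℂ) :
    (contractionMatrix G).transpose = -contractionMatrix G := by
  simp [contractionMatrix, Matrix.fromBlocks_transpose, Matrix.fromBlocks_neg]

variable [DecidableEq X]

/-- The basis vector of the letter `p`. -/
def letter (p : X ⊕ X) : X ⊕ X → ℂ := Pi.single p 1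

/-- The exterior product of a word of letters. -/
def wedge (l : List (X ⊕ X)) : ExteriorAlgebra ℂ (X ⊕ X → ℂ) :=
  (l.map fun p => ι ℂ (letter p)).prod

theorem wedge_append (l l' : List (X ⊕ X)) : wedge (l ++ l') = wedge l * wedge l' := by
  simp [wedge]

theorem wedge_cons (p : X ⊕ X) (l : List (X ⊕ X)) :
    wedge (p :: l) = ι ℂ (letter p) * wedge l := by
  simp [wedge]

theorem wedge_mul_comm (l l' : List (X ⊕ X)) :
    wedge l * wedge l' = (-1 : ℂ) ^ (l.length * l'.length) • (wedge l' * wedge l) := by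
  have h1 : ∀ (p : X ⊕ X) (l' : List (X ⊕ X)), ι ℂ (letter p) * wedge l' =
      (-1 : ℂ) ^ l'.length • (wedge l' * ι ℂ (letter p)) := by
    intro p l'
    induction l' with
    | nil => simp [wedge]
    | cons q l' ih =>
      have := ι_add_mul_swap (R := ℂ) (letter p) (letter q)
      rw [wedge_cons, ← mul_assoc, eq_neg_of_add_eq_zero_left this, neg_mul, mul_assoc, ih,
        List.length_cons, pow_succ, mul_smul_comm, mul_assoc]
      simp
  induction l with
  | nil => simp [wedge]
  | cons p l ih =>
    rw [wedge_cons, mul_assoc, ih, mul_smul_comm, ← mul_assoc, h1, smul_mul_assoc, smul_smul,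
      mul_assoc, ← pow_add, List.length_cons, add_mul, one_mul]

variable [Fintype X]

/-- The contraction as a bilinear form. -/
def contractionForm (G : Matrix X X ℂ) : LinearMap.BilinForm ℂ (X ⊕ X → ℂ) :=
  Matrix.toBilin' (contractionMatrix G)

theorem contractionForm_letter (G : Matrix X X ℂ) (p q : X ⊕ X) :
    contractionForm G (letter p) (letter q) = contractionMatrix G p q := by
  rw [contractionForm, letter, letter, Matrix.toBilin'_single]

theorem contractionForm_self (G : Matrix X X ℂ) (v : X ⊕ X → ℂ) : contractionForm G v v = 0 := by
  have h : contractionForm G v v = -contractionForm G v v := by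
    rw [contractionForm, Matrix.toBilin'_apply']
    conv_lhs => rw [dotProduct_comm, ← Matrix.vecMul_transpose, ← Matrix.dotProduct_mulVec,
      contractionMatrix_transpose, Matrix.neg_mulVec, dotProduct_neg]
  exact CharZero.eq_neg_self_iff.1 h

/-- Because the form is alternating, `changeForm` maps the exterior algebra to itself. The minus
sign compensates the one in `changeForm_ι_mul`, so that contractions enter `gaussian` positively. -/
theorem neg_contractionForm_toQuadraticMap (G : Matrix X X ℂ) :
    (-contractionForm G).toQuadraticMap =
      (0 : QuadraticForm ℂ (X ⊕ X → ℂ)) - (0 : QuadraticForm ℂ (X ⊕ X → ℂ)) := by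
  ext v
  simp [contractionForm_self]

/-- The Gaussian (quasi-free) functional with contraction `G`. -/
def gaussian (G : Matrix X X ℂ) : ExteriorAlgebra ℂ (X ⊕ X → ℂ) →ₗ[ℂ] ℂ :=
  algebraMapInv.toLinearMap ∘ₗ
    CliffordAlgebra.changeForm (neg_contractionForm_toQuadraticMap G)

theorem gaussian_one (G : Matrix X X ℂ) : gaussian G 1 = 1 := by
  rw [gaussian, LinearMap.comp_apply, CliffordAlgebra.changeForm_one]
  exact map_one algebraMapInv

/-- After the change of form, the product with the vector has no scalar part, so only the
contraction term survives. -/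
theorem gaussian_ι_mul (G : Matrix X X ℂ) (v : X ⊕ X → ℂ) (x : ExteriorAlgebra ℂ (X ⊕ X → ℂ)) :
    gaussian G (ι ℂ v * x) =
      gaussian G (CliffordAlgebra.contractLeft (contractionForm G v) x) := by
  simp only [gaussian, LinearMap.comp_apply]
  rw [CliffordAlgebra.changeForm_contractLeft, ι, CliffordAlgebra.changeForm_ι_mul]
  rw [AlgHom.toLinearMap_apply, map_sub, map_mul]
  have h0 : algebraMapInv (ι ℂ v) = 0 := by simp [algebraMapInv, ι]
  rw [ι] at h0
  rw [h0, zero_mul, zero_sub, LinearMap.neg_apply, map_neg, LinearMap.neg_apply, map_neg, neg_neg]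
  rfl

theorem gaussian_ofFn (G : Matrix X X ℂ) {N : ℕ} (p : X ⊕ X) (u : Fin (N + 1) → X ⊕ X) :
    gaussian G (wedge (p :: List.ofFn u)) =
      ∑ j : Fin (N + 1), (-1) ^ (j : ℕ) * contractionMatrix G p (u j) *
        gaussian G (wedge (List.ofFn fun i => u (j.succAbove i))) := by
  rw [wedge_cons, gaussian_ι_mul]
  simp only [wedge, List.map_ofFn]
  rw [show (fun p => ι ℂ (letter p)) ∘ u =
    fun i => ι ℂ (letter (u i)) from rfl,
    contractLeft_ofFn_ι_prod _ (fun i => letter (u i)), map_sum]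
  refine Finset.sum_congr rfl fun j _ => ?_
  rw [map_smul, smul_eq_mul, contractionForm_letter]
  rfl

/-- Wick's theorem: a product of fields has the Gaussian expectation of the corresponding word if
the two-point functions agree. -/
theorem thermal_ofFn_prod {Ω : Type*} [Fintype Ω] [LinearOrder Ω] (β : ℝ) {h : Matrix Ω Ω ℂ}
    (hh : h.IsHermitian) (G : Matrix X X ℂ) (M : ℕ) : ∀ {N : ℕ} (_ : N = 2 * M)
    (c : Fin N → FockOp Ω) (_ : ∀ j, IsField (c j)) (u : Fin N → X ⊕ X)
    (_ : ∀ i j, i < j → thermal β h (c i * c j) = contractionMatrix G (u i) (u j)),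
    thermal β h (List.ofFn c).prod = gaussian G (wedge (List.ofFn u)) := by
  induction M with
  | zero =>
    rintro _ rfl c _ u _
    simp [wedge, thermal_one β hh, gaussian_one]
  | succ M ih =>
    intro N hN c hc u hu
    obtain rfl : N = 2 * M + 1 + 1 := by omega
    -- Both functionals satisfy the same recursion. Removing letters keeps the order of the others,
    -- so two-point functions are needed only for pairs in the given order; this is what lets an
    -- antisymmetric matrix describe operators that do not anticommute.
    rw [List.ofFn_succ, List.prod_cons, thermal_mul_ofFn_prod β hh (even_two_mul M) (hc 0) _
      (fun j => hc _), List.ofFn_succ, gaussian_ofFn]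
    refine Finset.sum_congr rfl fun j _ => ?_
    rw [hu 0 j.succ (Fin.succ_pos j), ih rfl _ (fun _ => hc _) (fun i => u (j.succAbove i).succ)]
    intro i i' hi
    exact hu _ _ (Fin.succ_lt_succ_iff.2 (Fin.strictMono_succAbove j hi))

theorem thermal_list_prod {Ω : Type*} [Fintype Ω] [LinearOrder Ω] (β : ℝ) {h : Matrix Ω Ω ℂ}
    (hh : h.IsHermitian) (G : Matrix X X ℂ) (f : X ⊕ X → FockOp Ω) (hf : ∀ p, IsField (f p))
    {l : List (X ⊕ X)} (hl : Even l.length)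
    (hp : l.Pairwise fun p q => thermal β h (f p * f q) = contractionMatrix G p q) :
    thermal β h (l.map f).prod = gaussian G (wedge l) := by
  obtain ⟨M, hM⟩ := hl
  have := thermal_ofFn_prod β hh G M (by rw [hM]; ring) (fun i => f (l.get i)) (fun _ => hf _) l.get
    (fun i j hij => List.pairwise_iff_get.1 hp i j hij)
  rwa [List.ofFn_get, show (fun i => f (l.get i)) = f ∘ l.get from rfl, ← List.map_ofFn,
    List.ofFn_get] at this

/-! ### Normally ordered blocks and determinants -/

/-- The sign of the reversal of `m` letters. -/
def reversalSign (m : ℕ) : ℂ := (-1) ^ (m * (m - 1) / 2)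

theorem reversalSign_succ (m : ℕ) : reversalSign (m + 1) = (-1) ^ m * reversalSign m := by
  rw [reversalSign, reversalSign, ← pow_add, Nat.triangle_succ, add_comm]

theorem reversalSign_add (m k : ℕ) :
    reversalSign (m + k) = reversalSign m * reversalSign k * (-1) ^ (m * k) := by
  induction m with
  | zero => simp [reversalSign]
  | succ m ih =>
    rw [show m + 1 + k = m + k + 1 by ring, reversalSign_succ, ih, reversalSign_succ, add_mul,
      pow_add, pow_add]
    ring

theorem reversalSign_mul (m : ℕ) : (-1) ^ m * reversalSign m = (-1) ^ (m * (m + 1) / 2) := by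
  rw [← reversalSign_succ, reversalSign, Nat.add_sub_cancel, mul_comm]

theorem contractLeft_wedge_inl_mul (G : Matrix X X ℂ) (x : X) (l : List X)
    (z : ExteriorAlgebra ℂ (X ⊕ X → ℂ)) :
    CliffordAlgebra.contractLeft (contractionForm G (letter (Sum.inl x)))
      (wedge (l.map Sum.inl) * z) = (-1 : ℂ) ^ l.length • (wedge (l.map Sum.inl) *
        CliffordAlgebra.contractLeft (contractionForm G (letter (Sum.inl x))) z) := by
  induction l with
  | nil => simp [wedge]
  | cons y l ih =>
    rw [List.map_cons, wedge_cons, mul_assoc, ι, CliffordAlgebra.contractLeft_ι_mul, ih,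
      contractionForm_letter]
    simp [contractionMatrix, pow_succ, mul_assoc]

/-- Contracting the first annihilation letter passes over the `M` others, with sign (-1)^M, and then
expands the determinant along row 0. The signs accumulate to that of a reversal. -/
theorem gaussian_canonical (G : Matrix X X ℂ) {M : ℕ} (x y : Fin M → X) :
    gaussian G (wedge ((List.ofFn x).map Sum.inl) * wedge ((List.ofFn y).map Sum.inr)) =
      reversalSign M * (Matrix.of fun i j => G (x i) (y j)).det := by
  induction M with
  | zero => simp [wedge, gaussian_one, reversalSign]
  | succ M ih =>
    rw [List.ofFn_succ, List.map_cons, wedge_cons, mul_assoc, gaussian_ι_mul,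
      contractLeft_wedge_inl_mul, List.length_ofFn, map_smul]
    have e : CliffordAlgebra.contractLeft (contractionForm G (letter (Sum.inl (x 0))))
        (wedge ((List.ofFn y).map Sum.inr)) = ∑ j : Fin (M + 1), ((-1) ^ (j : ℕ) * G (x 0) (y j)) •
          wedge ((List.ofFn fun i => y (j.succAbove i)).map Sum.inr) := by
      simp only [wedge, List.map_ofFn]
      have := contractLeft_ofFn_ι_prod (contractionForm G (letter (Sum.inl (x 0))))
        (fun i => letter (Sum.inr (y i)))
      simp only [contractionForm_letter, contractionMatrix, Matrix.fromBlocks_apply₁₂] at this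
      exact this
    rw [e, Finset.mul_sum, map_sum (gaussian G), Matrix.det_succ_row_zero, reversalSign_succ,
      smul_eq_mul, mul_assoc, Finset.mul_sum, Finset.mul_sum, Finset.mul_sum]
    refine Finset.sum_congr rfl fun j _ => ?_
    rw [mul_smul_comm, map_smul, ih (fun i => x i.succ), smul_eq_mul, Matrix.of_apply,
      mul_left_comm (_ * _) (reversalSign M)]
    rfl

/-- The word of a list of blocks, each of which is normally ordered. -/
def blockWord {I : Type*} (xs : I → List X) (i : I) : List (X ⊕ X) :=
  (xs i).map Sum.inr ++ (xs i).map Sum.inl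

/-- Moving all annihilation letters to the left costs m² swaps inside a block of size `m` and mk
swaps against the `k` later annihilation letters. The latter cancel the cross term of
`reversalSign_add`, leaving a product of one sign per block. -/
theorem gaussian_wedge_blockWord {I : Type*} (G : Matrix X X ℂ) (xs : I → List X) (l : List I) :
    gaussian G (wedge (l.flatMap (blockWord xs))) =
      (l.map fun i => (-1 : ℂ) ^ ((xs i).length * ((xs i).length + 1) / 2)).prod *
        (Matrix.of fun i j => G ((l.flatMap xs).get i) ((l.flatMap xs).get j)).det := by
  have key : reversalSign (l.flatMap xs).length • wedge (l.flatMap (blockWord xs)) =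
      (l.map fun i => (-1 : ℂ) ^ ((xs i).length * ((xs i).length + 1) / 2)).prod •
        (wedge ((l.flatMap xs).map Sum.inl) * wedge ((l.flatMap xs).map Sum.inr)) := by
    induction l with
    | nil => simp [wedge, reversalSign]
    | cons i l ih =>
      rw [List.flatMap_cons, List.flatMap_cons, List.length_append, reversalSign_add, List.map_cons,
        List.prod_cons, ← reversalSign_mul, wedge_append, blockWord, wedge_append,
        wedge_mul_comm (List.map Sum.inr (xs i))]
      simp only [List.map_append, wedge_append, List.length_map]
      set m := (xs i).length
      set k := (l.flatMap xs).length
      have c : wedge ((xs i).map Sum.inr) * wedge ((l.flatMap xs).map Sum.inl) =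
          (-1 : ℂ) ^ (m * k) • (wedge ((l.flatMap xs).map Sum.inl) *
            wedge ((xs i).map Sum.inr)) := by
        rw [wedge_mul_comm, List.length_map, List.length_map]
      have hmm : (-1 : ℂ) ^ (m * m) = (-1) ^ m := by
        rw [pow_mul]
        rcases Nat.even_or_odd m with hm | hm <;> simp [hm.neg_one_pow]
      have hmk : (-1 : ℂ) ^ (m * k) * (-1) ^ (m * k) = 1 := by rw [← mul_pow]; simp
      set a := wedge ((xs i).map Sum.inl)
      set b := wedge ((xs i).map Sum.inr)
      set p := wedge ((l.flatMap xs).map Sum.inl)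
      set q := wedge ((l.flatMap xs).map Sum.inr)
      set w := wedge (l.flatMap (blockWord xs))
      set s := (l.map fun i => (-1 : ℂ) ^ ((xs i).length * ((xs i).length + 1) / 2)).prod
      calc (reversalSign m * reversalSign k * (-1) ^ (m * k)) • ((-1 : ℂ) ^ (m * m) • (a * b) * w)
          = (reversalSign m * (-1) ^ (m * k) * (-1 : ℂ) ^ m) • (a * b * (reversalSign k • w)) := by
            rw [hmm, smul_mul_assoc, mul_smul_comm, smul_smul, smul_smul]; congr 1; ring
        _ = (reversalSign m * (-1) ^ (m * k) * (-1 : ℂ) ^ m * s) • (a * (b * p) * q) := by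
            rw [ih, mul_smul_comm, smul_smul]; simp only [mul_assoc]
        _ = (((-1) ^ m * reversalSign m * s) * ((-1) ^ (m * k) * (-1 : ℂ) ^ (m * k))) •
              (a * (p * b) * q) := by
            rw [c, mul_smul_comm, smul_mul_assoc, smul_smul]; congr 1; ring
        _ = ((-1) ^ m * reversalSign m * s) • (a * p * (b * q)) := by
            rw [hmk, mul_one]; simp only [mul_assoc]
  have h2 := congrArg (gaussian G) key
  have h3 := gaussian_canonical G (l.flatMap xs).get (l.flatMap xs).get
  rw [List.ofFn_get] at h3
  rw [map_smul, map_smul, h3, smul_eq_mul, smul_eq_mul, mul_left_comm] at h2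
  refine mul_left_cancel₀ ?_ h2
  exact pow_ne_zero _ (by norm_num)

end Gaussian

/-! ### Correlations as determinants -/

section Correlation

variable {Ω : Type*} {s : ℕ}

/-- The letter `q` may stand to the right of the letter `p` in a time-ordered word. -/
def TimeOrdered {P : Fin s → Interaction Ω} (τ : Fin s → ℝ) :
    ((i : Fin s) × Fin (P i).m) ⊕ ((i : Fin s) × Fin (P i).m) →
      ((i : Fin s) × Fin (P i).m) ⊕ ((i : Fin s) × Fin (P i).m) → Prop
  | Sum.inl x, Sum.inr y => τ y.1 < τ x.1
  | Sum.inr y, Sum.inl x => τ x.1 ≤ τ y.1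
  | _, _ => True

/-- The positions of the `i`-th block. -/
def blockPositions (P : Fin s → Interaction Ω) (i : Fin s) : List ((i : Fin s) × Fin (P i).m) :=
  List.ofFn fun k => ⟨i, k⟩

theorem mem_blockPositions {P : Fin s → Interaction Ω} {i : Fin s}
    {x : (i : Fin s) × Fin (P i).m} : x ∈ blockPositions P i ↔ x.1 = i := by
  rw [blockPositions, List.mem_ofFn]
  constructor
  · rintro ⟨k, rfl⟩; rfl
  · rintro rfl; exact ⟨x.2, rfl⟩

theorem timeOrder_perm (τ : Fin s → ℝ) (B : Finset (Fin s)) :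
    (timeOrder τ B).Perm (B.sort (· ≤ ·)) :=
  List.perm_insertionSort _ _

theorem timeOrder_nodup (τ : Fin s → ℝ) (B : Finset (Fin s)) : (timeOrder τ B).Nodup :=
  (timeOrder_perm τ B).nodup_iff.2 (B.sort_nodup _)

theorem mem_timeOrder {τ : Fin s → ℝ} {B : Finset (Fin s)} {i : Fin s} :
    i ∈ timeOrder τ B ↔ i ∈ B := by
  rw [(timeOrder_perm τ B).mem_iff, Finset.mem_sort]

theorem timeOrder_pairwise {τ : Fin s → ℝ} (hτ : Function.Injective τ) (B : Finset (Fin s)) :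
    (timeOrder τ B).Pairwise fun i j => τ j < τ i := by
  have : Std.Total (fun i j : Fin s => τ j ≤ τ i) := ⟨fun i j => le_total _ _⟩
  have : IsTrans (Fin s) (fun i j : Fin s => τ j ≤ τ i) := ⟨fun i j k h1 h2 => h2.trans h1⟩
  have h1 : (timeOrder τ B).Pairwise fun i j => τ j ≤ τ i :=
    List.pairwise_insertionSort _ _
  have h2 : (timeOrder τ B).Pairwise fun i j => i ≠ j := timeOrder_nodup τ B
  exact (h1.and h2).imp fun h => lt_of_le_of_ne h.1 fun e => h.2 (hτ e).symm

theorem timeOrdered_word {P : Fin s → Interaction Ω} {τ : Fin s → ℝ} (hτ : Function.Injective τ)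
    (B : Finset (Fin s)) :
    ((timeOrder τ B).flatMap (blockWord (blockPositions P))).Pairwise (TimeOrdered τ) := by
  rw [List.pairwise_flatMap]
  constructor
  · intro i _
    rw [blockWord, List.pairwise_append]
    refine ⟨?_, ?_, ?_⟩
    · rw [List.pairwise_map]
      exact List.pairwise_of_forall fun _ _ => trivial
    · rw [List.pairwise_map]
      exact List.pairwise_of_forall fun _ _ => trivial
    · intro p hp q hq
      obtain ⟨x, hx, rfl⟩ := List.mem_map.1 hp
      obtain ⟨y, hy, rfl⟩ := List.mem_map.1 hq
      rw [mem_blockPositions] at hx hy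
      simp [TimeOrdered, hx, hy]
  · refine (timeOrder_pairwise hτ B).imp ?_
    intro i j hij p hp q hq
    rw [blockWord, List.mem_append, List.mem_map, List.mem_map] at hp hq
    rcases hp with ⟨x, hx, rfl⟩ | ⟨x, hx, rfl⟩ <;> rcases hq with ⟨y, hy, rfl⟩ | ⟨y, hy, rfl⟩ <;>
    rw [mem_blockPositions] at hx hy <;> simp [TimeOrdered, hx, hy, hij, hij.le]

variable [Fintype Ω] [LinearOrder Ω]

/-- The matrix of the Green's functions between all annihilation and all creation operators. -/
def greenMatrix (β : ℝ) (h : Matrix Ω Ω ℂ) (P : Fin s → Interaction Ω) (τ : Fin s → ℝ) :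
    Matrix ((i : Fin s) × Fin (P i).m) ((i : Fin s) × Fin (P i).m) ℂ :=
  Matrix.of fun r c => green β h (τ r.1 - τ c.1) ((P r.1).minus r.2) ((P c.1).plus c.2)

/-- The time-evolved field of a letter. -/
def field (h : Matrix Ω Ω ℂ) (P : Fin s → Interaction Ω) (τ : Fin s → ℝ) :
    ((i : Fin s) × Fin (P i).m) ⊕ ((i : Fin s) × Fin (P i).m) → FockOp Ω
  | Sum.inl x => evolve h (τ x.1) (annih ((P x.1).minus x.2))
  | Sum.inr x => evolve h (τ x.1) (creat ((P x.1).plus x.2))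

theorem isField_field (h : Matrix Ω Ω ℂ) (P : Fin s → Interaction Ω) (τ : Fin s → ℝ)
    (p : ((i : Fin s) × Fin (P i).m) ⊕ ((i : Fin s) × Fin (P i).m)) : IsField (field h P τ p) := by
  rcases p with x | x
  · exact IsField.evolve (Or.inl (annih_mem _)) h _
  · exact IsField.evolve (Or.inr (creat_mem _)) h _

theorem thermal_evolve_mul_evolve (β : ℝ) (h : Matrix Ω Ω ℂ) (t u : ℝ) (A B : FockOp Ω) :
    thermal β h (evolve h t A * evolve h u B) = thermal β h (evolve h (t - u) A * B) := by
  rw [← thermal_evolve β h u (evolve h (t - u) A * B), evolve_mul, evolve_evolve]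
  congr 4
  ring

theorem thermal_evolve_mul_evolve' (β : ℝ) (h : Matrix Ω Ω ℂ) (t u : ℝ) (A B : FockOp Ω) :
    thermal β h (evolve h t A * evolve h u B) = thermal β h (A * evolve h (u - t) B) := by
  rw [← thermal_evolve β h t (A * evolve h (u - t) B), evolve_mul, evolve_evolve]
  congr 4
  ring

/-- Time-translation invariance leaves only time differences. Equal times occur with the creation
operator on the left, where the branch `τ ≤ 0` of `green` is the right one. -/
theorem thermal_field_mul_field (β : ℝ) {h : Matrix Ω Ω ℂ} (hh : h.IsHermitian)
    {P : Fin s → Interaction Ω} {τ : Fin s → ℝ}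
    {p q : ((i : Fin s) × Fin (P i).m) ⊕ ((i : Fin s) × Fin (P i).m)} (hpq : TimeOrdered τ p q) :
    thermal β h (field h P τ p * field h P τ q) =
      contractionMatrix (greenMatrix β h P τ) p q := by
  rcases p with x | x <;> rcases q with y | y
  · exact thermal_annihSpan_mul β hh (evolve_mem (adInvariant_annihSpan h) _ (annih_mem _))
      (evolve_mem (adInvariant_annihSpan h) _ (annih_mem _))
  · have : ¬ (τ x.1 - τ y.1 ≤ 0) := by simpa [TimeOrdered] using hpq
    simp only [field, thermal_evolve_mul_evolve, contractionMatrix, Matrix.fromBlocks_apply₁₂,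
      greenMatrix, Matrix.of_apply, green, if_neg this]
  · have : τ y.1 - τ x.1 ≤ 0 := by simpa [TimeOrdered] using hpq
    simp only [field, thermal_evolve_mul_evolve', contractionMatrix, Matrix.fromBlocks_apply₂₁,
      greenMatrix, Matrix.neg_apply, Matrix.transpose_apply, Matrix.of_apply, green, if_pos this,
      neg_neg]
  · exact thermal_creatSpan_mul β hh (evolve_mem (adInvariant_creatSpan h) _ (creat_mem _))
      (evolve_mem (adInvariant_creatSpan h) _ (creat_mem _))

theorem evolve_op (h : Matrix Ω Ω ℂ) (P : Fin s → Interaction Ω) (τ : Fin s → ℝ) (i : Fin s) :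
    evolve h (τ i) (P i).op = ((blockWord (blockPositions P) i).map (field h P τ)).prod := by
  rw [Interaction.op, evolve_mul, evolve_list_prod, evolve_list_prod, blockWord, List.map_append,
    List.prod_append]
  simp only [List.map_ofFn, blockPositions]
  rfl

theorem correlation_eq_det (β : ℝ) {h : Matrix Ω Ω ℂ} (hh : h.IsHermitian)
    (P : Fin s → Interaction Ω) {τ : Fin s → ℝ} (hτ : Function.Injective τ) (B : Finset (Fin s)) :
    correlation β h P τ B = (∏ i ∈ B, ((interactionSign (P i) : ℤ) : ℂ)) *
      ((greenMatrix β h P τ).submatrix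
        (Subtype.val : {x : (i : Fin s) × Fin (P i).m // x.1 ∈ B} → _) Subtype.val).det := by
  set l := timeOrder τ B with hl
  have e1 : (l.map fun i => evolve h (τ i) (P i).op).prod =
      ((l.flatMap (blockWord (blockPositions P))).map (field h P τ)).prod := by
    rw [List.map_flatMap, List.flatMap, List.prod_flatten, List.map_map]
    congr 1
    exact List.map_congr_left fun i _ => evolve_op h P τ i
  have hev : Even (l.flatMap (blockWord (blockPositions P))).length := by
    rw [List.length_flatMap]
    have : l.map (fun i => (blockWord (blockPositions P) i).length) =
        l.map fun i => 2 * (P i).m :=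
      List.map_congr_left fun i _ => by simp [blockWord, blockPositions, two_mul]
    rw [this, List.sum_map_mul_left]
    exact even_two_mul _
  rw [correlation, ← hl, e1, thermal_list_prod β hh (greenMatrix β h P τ) (field h P τ)
    (isField_field h P τ) hev ((timeOrdered_word hτ B).imp (thermal_field_mul_field β hh)),
    gaussian_wedge_blockWord]
  have hnd : (l.flatMap (blockPositions P)).Nodup := by
    rw [List.nodup_flatMap]
    refine ⟨fun i _ => List.nodup_ofFn.2 fun a b hab => by simpa using hab, ?_⟩
    refine List.Pairwise.imp ?_ (timeOrder_nodup τ B)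
    intro i j hij x hx hy
    rw [mem_blockPositions] at hx hy
    exact hij (hx.symm.trans hy)
  have hmem : ∀ x, x ∈ l.flatMap (blockPositions P) ↔ x.1 ∈ B := fun x => by
    simp [List.mem_flatMap, mem_blockPositions, hl, mem_timeOrder]
  congr 1
  · rw [← List.prod_toFinset _ (timeOrder_nodup τ B)]
    have : l.toFinset = B := by ext i; simp [hl, mem_timeOrder]
    rw [← hl, this]
    refine Finset.prod_congr rfl fun i _ => ?_
    simp [interactionSign, blockPositions]
  -- Time ordering permutes rows and columns simultaneously, so the determinant no longer depends on
  -- it.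
  · let e : Fin (l.flatMap (blockPositions P)).length ≃
        {x : (i : Fin s) × Fin (P i).m // x.1 ∈ B} :=
      (hnd.getEquiv _).trans (Equiv.subtypeEquivRight hmem)
    rw [← Matrix.det_submatrix_equiv_self e]
    rfl

end Correlation

/-! ### Connectedness and the sum over set partitions -/

section Partitions

open Finset Polynomial

theorem part_eq_part_iff {V : Type*} [Fintype V] [DecidableEq V]
    (Q : Finpartition (univ : Finset V)) (v w : V) : Q.part v = Q.part w ↔ v ∈ Q.part w := by
  rw [Q.mem_part_iff_part_eq_part (mem_univ _) (mem_univ _)]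

theorem finpartition_eq_of_part {V : Type*} [Fintype V] [DecidableEq V]
    {Q Q' : Finpartition (univ : Finset V)}
    (h : ∀ v w, Q.part v = Q.part w ↔ Q'.part v = Q'.part w) : Q = Q' := by
  have hp : ∀ w, Q.part w = Q'.part w := fun w => by
    ext v
    rw [← part_eq_part_iff, ← part_eq_part_iff, h]
  have himg : ∀ R : Finpartition (univ : Finset V), R.parts = univ.image R.part := fun R => by
    ext B
    simp only [mem_image, mem_univ, true_and]
    constructor
    · intro hB
      obtain ⟨v, hv⟩ := R.nonempty_of_mem_parts hB
      exact ⟨v, R.part_eq_of_mem hB hv⟩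
    · rintro ⟨v, rfl⟩
      exact R.part_mem.2 (mem_univ v)
  ext1
  rw [himg, himg, funext hp]

/-- The function `f` takes equal values exactly on the blocks of `Q`. -/
def IsKernel {V α : Type*} [Fintype V] [DecidableEq V] (f : V → α)
    (Q : Finpartition (univ : Finset V)) : Prop :=
  ∀ v w, f v = f w ↔ Q.part v = Q.part w

theorem existsUnique_isKernel {V α : Type*} [Fintype V] [DecidableEq V] (f : V → α) :
    ∃! Q : Finpartition (univ : Finset V), IsKernel f Q := by
  classical
  refine ⟨Finpartition.ofSetoid (Setoid.ker f), fun v w => ?_, fun Q hQ => ?_⟩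
  · rw [part_eq_part_iff, Finpartition.mem_part_ofSetoid_iff_rel, Setoid.ker_def, eq_comm]
  · refine finpartition_eq_of_part fun v w => ?_
    rw [← hQ v w, part_eq_part_iff, Finpartition.mem_part_ofSetoid_iff_rel, Setoid.ker_def, eq_comm]

/-- A map with kernel `Q` is an injective colouring of the parts of `Q`. -/
theorem card_isKernel {V : Type*} [Fintype V] [DecidableEq V]
    (Q : Finpartition (univ : Finset V)) (q : ℕ) :
    Nat.card {f : V → Fin q // IsKernel f Q} = q.descFactorial #Q.parts := by
  have hne : ∀ B : Q.parts, ∃ v, v ∈ B.1 := fun B => Q.nonempty_of_mem_parts B.2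
  choose r hr using hne
  have hr' : ∀ B : Q.parts, Q.part (r B) = B.1 := fun B => Q.part_eq_of_mem B.2 (hr B)
  let e : {f : V → Fin q // IsKernel f Q} ≃ (Q.parts ↪ Fin q) :=
    { toFun := fun f => ⟨fun B => f.1 (r B), fun B C hBC => by
        have := (f.2 _ _).1 hBC
        rw [hr', hr'] at this
        exact Subtype.ext this⟩
      invFun := fun g => ⟨fun v => g ⟨Q.part v, Q.part_mem.2 (mem_univ v)⟩, fun v w => by
        rw [g.injective.eq_iff, Subtype.mk.injEq]⟩
      left_inv := fun f => by
        ext1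
        funext v
        exact (f.2 _ _).2 (hr' _)
      right_inv := fun g => by
        ext B
        simp [hr'] }
  rw [Nat.card_congr e, Nat.card_eq_fintype_card, Fintype.card_embedding_eq, Fintype.card_fin,
    Fintype.card_coe]

theorem descPochhammer_eval_neg_one (k : ℕ) :
    (descPochhammer ℂ k).eval (-1) = (-1) ^ k * (k.factorial : ℂ) := by
  induction k with
  | zero => simp
  | succ k ih =>
    rw [descPochhammer_succ_right, eval_mul, ih, Nat.factorial_succ]
    simp
    ring

/-- Dividing the falling factorial by `X` and setting `X = 0` evaluates the falling factorial of
order `k - 1` at -1. Thus the cumulant coefficients are linear coefficients. -/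
theorem descPochhammer_coeff_one {k : ℕ} (hk : k ≠ 0) :
    (descPochhammer ℂ k).coeff 1 = (-1) ^ (k - 1) * ((k - 1).factorial : ℂ) := by
  obtain ⟨k, rfl⟩ := Nat.exists_eq_succ_of_ne_zero hk
  rw [Nat.succ_eq_add_one, descPochhammer_succ_left, show (1 : ℕ) = 0 + 1 from rfl, coeff_X_mul,
    coeff_zero_eq_eval_zero, eval_comp]
  simp [descPochhammer_eval_neg_one]

/-- The partition `Q` does not separate adjacent vertices of `H`. -/
def Respects {V : Type*} [Fintype V] [DecidableEq V] (H : SimpleGraph V)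
    (Q : Finpartition (univ : Finset V)) : Prop :=
  ∀ v w, H.Adj v w → Q.part v = Q.part w

theorem card_constant_on_components {V : Type*} (H : SimpleGraph V) (q : ℕ) [Finite V] :
    Nat.card {f : V → Fin q // ∀ v w, H.Adj v w → f v = f w} =
      q ^ Nat.card H.ConnectedComponent := by
  have hreach : ∀ f : V → Fin q, (∀ v w, H.Adj v w → f v = f w) →
      ∀ v w, H.Reachable v w → f v = f w := by
    rintro f hf v w ⟨p⟩
    induction p with
    | nil => rfl
    | cons h _ ih => exact (hf _ _ h).trans ih
  let e : {f : V → Fin q // ∀ v w, H.Adj v w → f v = f w} ≃ (H.ConnectedComponent → Fin q) :=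
    { toFun := fun f => Quot.lift f.1 (hreach f.1 f.2)
      invFun := fun g => ⟨fun v => g (H.connectedComponentMk v), fun v w hvw => by
        exact congrArg g (SimpleGraph.ConnectedComponent.sound hvw.reachable)⟩
      left_inv := fun f => rfl
      right_inv := fun g => by
        funext c
        induction c using SimpleGraph.ConnectedComponent.ind
        rfl }
  rw [Nat.card_congr e, Nat.card_fun, Nat.card_eq_fintype_card, Fintype.card_fin]

open scoped Classical in
-- At every natural number `q`, both sides count the `q`-colourings of `V` constant along the edges
-- of `H`: once sorted by their kernel, once by components. Infinitely many values determine a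
-- polynomial.
theorem sum_partitions_descPochhammer {V : Type*} [Fintype V] [DecidableEq V] (H : SimpleGraph V) :
    ∑ Q : Finpartition (univ : Finset V) with Respects H Q, descPochhammer ℂ #Q.parts =
      X ^ Nat.card H.ConnectedComponent := by
  refine Polynomial.eq_of_infinite_eval_eq _ _ (Set.Infinite.mono ?_
    (Set.infinite_range_of_injective (Nat.cast_injective (R := ℂ))))
  rintro _ ⟨q, rfl⟩
  rw [Set.mem_ofPred_eq, eval_finsetSum, eval_pow, eval_X, ← Nat.cast_pow,
    ← card_constant_on_components H q]
  simp only [descPochhammer_eval_eq_descFactorial]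
  rw [← Nat.cast_sum]
  congr 1
  simp only [← card_isKernel, Nat.card_eq_fintype_card, Fintype.card_subtype]
  rw [← Finset.card_sigma]
  refine Finset.card_bij (fun p _ => p.2) ?_ ?_ ?_
  · rintro ⟨Q, f⟩ h
    simp only [mem_sigma, mem_filter, mem_univ, true_and] at h ⊢
    exact fun v w hvw => (h.2 v w).2 (h.1 v w hvw)
  · rintro ⟨Q, f⟩ h ⟨Q', f'⟩ h' e
    simp only [mem_sigma, mem_filter, mem_univ, true_and] at h h' e
    subst e
    rw [(existsUnique_isKernel f).unique h.2 h'.2]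
  · intro f hf
    obtain ⟨Q, hQ, -⟩ := existsUnique_isKernel f
    simp only [mem_filter, mem_univ, true_and] at hf
    refine ⟨⟨Q, f⟩, ?_, rfl⟩
    simp only [mem_sigma, mem_filter, mem_univ, true_and]
    exact ⟨fun v w hvw => (hQ v w).1 (hf v w hvw), hQ⟩

open scoped Classical in
/-- The cumulant coefficients single out the connected graphs. -/
theorem sum_partitions_respects {V : Type*} [Fintype V] [DecidableEq V] [Nonempty V]
    (H : SimpleGraph V) :
    ∑ Q : Finpartition (univ : Finset V) with Respects H Q,
      (-1 : ℂ) ^ (#Q.parts - 1) * ((#Q.parts - 1).factorial : ℂ) =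
        if H.Connected then 1 else 0 := by
  -- The linear coefficient of X^c, with c the number of components, is 1 exactly when c = 1.
  have h := congrArg (fun p => coeff p 1) (sum_partitions_descPochhammer H)
  simp only [finsetSum_coeff, coeff_X_pow] at h
  have hQ : ∀ Q : Finpartition (univ : Finset V), #Q.parts ≠ 0 := fun Q => by
    rw [Finset.card_ne_zero]
    exact Q.parts_nonempty (univ_nonempty.ne_empty)
  rw [Finset.sum_congr rfl fun Q _ => descPochhammer_coeff_one (hQ Q)] at h
  rw [h]
  congr 1
  rw [eq_iff_iff, eq_comm, Nat.card_eq_one_iff_unique]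
  constructor
  · rintro ⟨h1, -⟩
    refine { preconnected := fun v w => ?_, nonempty := inferInstance }
    exact SimpleGraph.ConnectedComponent.exact (Subsingleton.elim _ _)
  · intro hc
    exact ⟨hc.preconnected.subsingleton_connectedComponent,
      ⟨H.connectedComponentMk (Classical.arbitrary V)⟩⟩

end Partitions

/-! ### Determinants of blocks as sums over permutations -/

section BlockDet

open Finset

theorem det_eq_sum_row {X : Type*} [Fintype X] [DecidableEq X] (M : Matrix X X ℂ) :
    M.det = ∑ σ : Equiv.Perm X, ((Equiv.Perm.sign σ : ℤ) : ℂ) * ∏ x, M x (σ x) := by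
  rw [← Matrix.det_transpose, Matrix.det_apply']
  rfl

open scoped Classical in
-- Setting to zero the entries of `G` between different parts makes the matrix block diagonal and
-- discards exactly the permutations that leave a part.
theorem prod_det_blocks {X : Type*} [Fintype X] [DecidableEq X] {s : ℕ} (blk : X → Fin s)
    (G : Matrix X X ℂ) (Q : Finpartition (univ : Finset (Fin s))) :
    ∏ B ∈ Q.parts, (G.submatrix (Subtype.val : {x // blk x ∈ B} → X) Subtype.val).det =
      ∑ σ : Equiv.Perm X with (∀ x, Q.part (blk x) = Q.part (blk (σ x))),
        ((Equiv.Perm.sign σ : ℤ) : ℂ) * ∏ x, G x (σ x) := by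
  -- Block triangularity needs some linear order on the parts; the colexicographic one serves, and
  -- its choice is immaterial.
  let b : X → Colex (Finset (Fin s)) := fun x => toColex (Q.part (blk x))
  let M : Matrix X X ℂ := Matrix.of fun x y => if Q.part (blk x) = Q.part (blk y) then G x y else 0
  have hM : M.BlockTriangular b := by
    intro x y hxy
    simp only [M, Matrix.of_apply]
    rw [if_neg]
    intro h
    simp only [b, h] at hxy
    exact lt_irrefl _ hxy
  have h1 : M.det = ∑ σ : Equiv.Perm X with (∀ x, Q.part (blk x) = Q.part (blk (σ x))),
        ((Equiv.Perm.sign σ : ℤ) : ℂ) * ∏ x, G x (σ x) := by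
    rw [det_eq_sum_row, Finset.sum_filter]
    refine Finset.sum_congr rfl fun σ _ => ?_
    split_ifs with h
    · congr 1
      exact Finset.prod_congr rfl fun x _ => if_pos (h x)
    · obtain ⟨x, hx⟩ := not_forall.1 h
      rw [Finset.prod_eq_zero (mem_univ x), mul_zero]
      exact if_neg hx
  rw [← h1, hM.det]
  have h2 : univ.image b ⊆ Q.parts.image toColex := by
    intro B hB
    obtain ⟨x, -, rfl⟩ := mem_image.1 hB
    exact mem_image_of_mem _ (Q.part_mem.2 (mem_univ _))
  rw [Finset.prod_subset h2]
  · rw [Finset.prod_image (fun _ _ _ _ h => toColex.injective h)]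
    refine Finset.prod_congr rfl fun B hB => ?_
    have hb : ∀ x, blk x ∈ B ↔ b x = toColex B := fun x => by
      simp only [b, toColex.injective.eq_iff]
      exact (Q.part_eq_iff_mem hB).symm
    rw [← Matrix.det_submatrix_equiv_self (Equiv.subtypeEquivRight hb)]
    congr 1
    ext x y
    simp only [Matrix.toSquareBlock_def, Matrix.submatrix_apply, M, Matrix.of_apply]
    rw [if_pos]
    · rfl
    · exact (Q.part_eq_of_mem hB x.2).trans (Q.part_eq_of_mem hB y.2).symm
  -- Parts containing no operator, whose interactions all have `m = 0`, contribute an empty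
  -- determinant, which is 1.
  · intro B _ hB
    have : IsEmpty {x // b x = B} := ⟨fun x => hB (mem_image.2 ⟨x.1, mem_univ _, x.2⟩)⟩
    exact Matrix.det_isEmpty

/-- The graph whose edges are the pairs of blocks linked by the permutation `σ`. -/
def linkGraph {X V : Type*} (blk : X → V) (σ : Equiv.Perm X) : SimpleGraph V :=
  SimpleGraph.fromRel fun v w => ∃ x, blk x = v ∧ blk (σ x) = w

theorem respects_linkGraph {X V : Type*} [Fintype V] [DecidableEq V] (blk : X → V)
    (σ : Equiv.Perm X) (Q : Finpartition (univ : Finset V)) :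
    Respects (linkGraph blk σ) Q ↔ ∀ x, Q.part (blk x) = Q.part (blk (σ x)) := by
  constructor
  · intro h x
    by_cases hx : blk x = blk (σ x)
    · rw [← hx]
    · exact h _ _ ⟨hx, Or.inl ⟨x, rfl, rfl⟩⟩
  · rintro h v w ⟨-, ⟨x, rfl, rfl⟩ | ⟨x, rfl, rfl⟩⟩
    · exact h x
    · exact (h x).symm

open scoped Classical in
/-- The connected part of a determinant is the sum over the permutations with connected link
graph. -/
theorem connected_part_det {X : Type*} [Fintype X] [DecidableEq X] {n : ℕ} (blk : X → Fin (n + 1))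
    (G : Matrix X X ℂ) :
    ∑ Q : Finpartition (univ : Finset (Fin (n + 1))),
      (-1 : ℂ) ^ (#Q.parts - 1) * ((#Q.parts - 1).factorial : ℂ) *
        ∏ B ∈ Q.parts, (G.submatrix (Subtype.val : {x // blk x ∈ B} → X) Subtype.val).det =
    ∑ σ : Equiv.Perm X, ((Equiv.Perm.sign σ : ℤ) : ℂ) * (∏ x, G x (σ x)) *
      if (linkGraph blk σ).Connected then 1 else 0 := by
  simp only [prod_det_blocks, ← sum_partitions_respects, respects_linkGraph, Finset.mul_sum,
    Finset.sum_filter]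
  rw [Finset.sum_comm]
  refine Finset.sum_congr rfl fun σ _ => Finset.sum_congr rfl fun Q _ => ?_
  split_ifs
  · ring
  · simp

end BlockDet

/-! ### Deleting contracted rows and columns -/

section Laplace

open Finset

/-- Expand along the unit rows one at a time, starting with the last. The inversion product corrects
for the columns renumbered by each deletion. -/
theorem det_delete_unit_rows {k : ℕ} : ∀ {N m : ℕ} (M : Matrix (Fin N) (Fin N) ℂ)
    (r c : Fin k → Fin N) (_ : StrictMono r) (_ : Function.Injective c)
    (_ : ∀ p y, M (r p) y = if y = c p then 1 else 0) (f g : Fin m → Fin N)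
    (_ : StrictMono f) (_ : StrictMono g) (_ : Set.range f = (Set.range r)ᶜ)
    (_ : Set.range g = (Set.range c)ᶜ),
    M.det = (∏ p, (-1 : ℂ) ^ ((r p : ℕ) + (c p : ℕ))) *
      (∏ q, ∏ p, if p < q ∧ c q < c p then (-1 : ℂ) else 1) * (M.submatrix f g).det := by
  induction k with
  | zero =>
    intro N m M r c hr hc hM f g hf hg hfr hgc
    simp only [Set.range_eq_empty, Set.compl_empty] at hfr hgc
    obtain rfl : f = g := by
      rw [← hf.range_inj hg, hfr, hgc]
    let e : Fin m ≃ Fin N := Equiv.ofBijective f ⟨hf.injective, Set.range_eq_univ.1 hfr⟩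
    have h : (M.submatrix f f).det = M.det := Matrix.det_submatrix_equiv_self e M
    rw [h]
    simp
  | succ k ih =>
    intro N m M r c hr hc hM f g hf hg hfr hgc
    obtain _ | N := N
    · exact (r 0).elim0
    set r₀ := r (Fin.last k) with hr₀
    set c₀ := c (Fin.last k) with hc₀
    have hrlt : ∀ p : Fin k, r p.castSucc < r₀ := fun p => hr (Fin.castSucc_lt_last p)
    have hcne : ∀ p : Fin k, c p.castSucc ≠ c₀ := fun p h => (Fin.castSucc_lt_last p).ne (hc h)
    have hfne : ∀ a, f a ≠ r₀ := fun a h => by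
      have : f a ∈ (Set.range r)ᶜ := hfr ▸ Set.mem_range_self a
      exact this ⟨_, h.symm⟩
    have hgne : ∀ a, g a ≠ c₀ := fun a h => by
      have : g a ∈ (Set.range c)ᶜ := hgc ▸ Set.mem_range_self a
      exact this ⟨_, h.symm⟩
    choose r' hr' using fun p => Fin.exists_succAbove_eq (hrlt p).ne
    choose c' hc' using fun p => Fin.exists_succAbove_eq (hcne p)
    choose f' hf' using fun a => Fin.exists_succAbove_eq (hfne a)
    choose g' hg' using fun a => Fin.exists_succAbove_eq (hgne a)
    have hrow : M.det = (-1 : ℂ) ^ ((r₀ : ℕ) + (c₀ : ℕ)) *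
        (M.submatrix r₀.succAbove c₀.succAbove).det := by
      rw [Matrix.det_succ_row M r₀, Finset.sum_eq_single c₀]
      · rw [hM, if_pos rfl, mul_one]
      · intro j _ hj
        rw [hM, if_neg hj]; simp
      · simp
    have hr'm : StrictMono r' := fun p q hpq => by
      rw [← (Fin.strictMono_succAbove r₀).lt_iff_lt, hr', hr']
      exact hr (Fin.castSucc_lt_castSucc_iff.2 hpq)
    have hc'i : Function.Injective c' := fun p q hpq => by
      have := congrArg c₀.succAbove hpq
      rw [hc', hc'] at this
      exact Fin.castSucc_injective k (hc this)
    have hf'm : StrictMono f' := fun p q hpq => by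
      rw [← (Fin.strictMono_succAbove r₀).lt_iff_lt, hf', hf']
      exact hf hpq
    have hg'm : StrictMono g' := fun p q hpq => by
      rw [← (Fin.strictMono_succAbove c₀).lt_iff_lt, hg', hg']
      exact hg hpq
    have range_aux : ∀ (z : Fin (N + 1)) (u : Fin (k + 1) → Fin (N + 1)) (u' : Fin k → Fin N)
        (v : Fin m → Fin (N + 1)) (v' : Fin m → Fin N), u (Fin.last k) = z →
        (∀ p, z.succAbove (u' p) = u p.castSucc) → (∀ a, z.succAbove (v' a) = v a) →
        Set.range v = (Set.range u)ᶜ → Set.range v' = (Set.range u')ᶜ := by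
      intro z u u' v v' huz hu hv h
      ext y
      have h1 : y ∈ Set.range v' ↔ z.succAbove y ∈ Set.range v := by
        simp only [Set.mem_range]
        refine exists_congr fun a => ?_
        rw [← hv, Fin.succAbove_right_inj]
      have h2 : y ∈ Set.range u' ↔ z.succAbove y ∈ Set.range u := by
        simp only [Set.mem_range, Fin.exists_fin_succ', huz]
        constructor
        · rintro ⟨p, rfl⟩; exact Or.inl ⟨p, (hu p).symm⟩
        · rintro (⟨p, hp⟩ | hp)
          · exact ⟨p, by rwa [← hu, Fin.succAbove_right_inj] at hp⟩
          · exact absurd hp.symm (Fin.succAbove_ne z y)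
      rw [h1, h, Set.mem_compl_iff, Set.mem_compl_iff, h2]
    have IH := ih (M.submatrix r₀.succAbove c₀.succAbove) r' c' hr'm hc'i
      (fun p y => by
        rw [Matrix.submatrix_apply, hr', hM]
        refine if_congr ?_ rfl rfl
        rw [← hc', Fin.succAbove_right_inj])
      f' g' hf'm hg'm (range_aux r₀ r r' f f' rfl hr' hf' hfr)
      (range_aux c₀ c c' g g' rfl hc' hg' hgc)
    have hsub : (M.submatrix r₀.succAbove c₀.succAbove).submatrix f' g' = M.submatrix f g := by
      ext a b
      simp only [Matrix.submatrix_apply, hf', hg']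
    -- The deleted row is the largest, so the other contracted rows keep their numbers; a column
    -- drops by one exactly if it lies beyond `c₀`, that is, if it forms an inversion with the last
    -- pair.
    have hrv : ∀ p, ((r' p : Fin N) : ℕ) = (r p.castSucc : ℕ) := fun p => by
      have h1 := hr' p
      have h2 : (r' p).castSucc < r₀ := by
        rw [← Fin.succAbove_lt_iff_castSucc_lt, h1]; exact hrlt p
      rw [← h1, Fin.succAbove_of_castSucc_lt _ _ h2, Fin.val_castSucc]
    have hcv : ∀ p, (-1 : ℂ) ^ (c p.castSucc : ℕ) =
        (-1) ^ (c' p : ℕ) * if c₀ < c p.castSucc then (-1 : ℂ) else 1 := fun p => by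
      have h1 := hc' p
      split_ifs with h
      · have h2 : c₀ ≤ (c' p).castSucc := by
          rw [← Fin.lt_succAbove_iff_le_castSucc, h1]; exact h
        rw [← h1, Fin.succAbove_of_le_castSucc _ _ h2, Fin.val_succ, pow_succ]
      · have h2 : (c' p).castSucc < c₀ := by
          rw [← Fin.succAbove_lt_iff_castSucc_lt, h1]
          exact lt_of_le_of_ne (not_lt.1 h) (hcne p)
        rw [← h1, Fin.succAbove_of_castSucc_lt _ _ h2, Fin.val_castSucc, mul_one]
    have hlt : ∀ p q, c q.castSucc < c p.castSucc ↔ c' q < c' p := fun p q => by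
      rw [← hc', ← hc', (Fin.strictMono_succAbove c₀).lt_iff_lt]
    rw [hrow, IH, hsub, Fin.prod_univ_castSucc, Fin.prod_univ_castSucc (n := k)]
    have e1 : ∀ q : Fin k, (∏ p : Fin (k + 1),
        if p < q.castSucc ∧ c q.castSucc < c p then (-1 : ℂ) else 1) =
        ∏ p : Fin k, if p < q ∧ c' q < c' p then (-1 : ℂ) else 1 := fun q => by
      rw [Fin.prod_univ_castSucc, if_neg (fun h => absurd h.1 (Fin.le_last _).not_gt), mul_one]
      simp only [Fin.castSucc_lt_castSucc_iff, hlt]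
    have e2 : (∏ p : Fin (k + 1), if p < Fin.last k ∧ c (Fin.last k) < c p then (-1 : ℂ) else 1) =
        ∏ p : Fin k, if c₀ < c p.castSucc then (-1 : ℂ) else 1 := by
      rw [Fin.prod_univ_castSucc, if_neg (fun h => absurd h.1 (lt_irrefl _)), mul_one]
      simp only [Fin.castSucc_lt_last, true_and, hc₀]
    have e3 : (∏ p : Fin k, (-1 : ℂ) ^ ((r p.castSucc : ℕ) + (c p.castSucc : ℕ))) =
        (∏ p, (-1 : ℂ) ^ ((r' p : ℕ) + (c' p : ℕ))) *
          ∏ p : Fin k, if c₀ < c p.castSucc then (-1 : ℂ) else 1 := by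
      rw [← Finset.prod_mul_distrib]
      refine Finset.prod_congr rfl fun p _ => ?_
      rw [pow_add, pow_add, hcv, hrv, mul_assoc]
    have e4 : (∏ p : Fin k, if c₀ < c p.castSucc then (-1 : ℂ) else 1) *
        (∏ p : Fin k, if c₀ < c p.castSucc then (-1 : ℂ) else 1) = 1 := by
      rw [← Finset.prod_mul_distrib]
      refine Finset.prod_eq_one fun p _ => ?_
      split_ifs <;> norm_num
    rw [e2, e3, ← hr₀, ← hc₀]
    simp only [e1]
    set A := ∏ p : Fin k, if c₀ < c p.castSucc then (-1 : ℂ) else 1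
    set C := ∏ p, (-1 : ℂ) ^ ((r' p : ℕ) + (c' p : ℕ))
    set D := ∏ q : Fin k, ∏ p : Fin k, if p < q ∧ c' q < c' p then (-1 : ℂ) else 1
    linear_combination (-(-1 : ℂ) ^ ((r₀ : ℕ) + (c₀ : ℕ)) * C * D * (M.submatrix f g).det) * e4

theorem exists_equiv_strictMono {E : Type*} [Fintype E] {N : ℕ} (r : E → Fin N)
    (hr : Function.Injective r) :
    ∃ e : Fin (Fintype.card E) ≃ E, StrictMono fun p => r (e p) := by
  let S : Finset (Fin N) := univ.map ⟨r, hr⟩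
  have hS : #S = Fintype.card E := by simp [S]
  have hmem : ∀ p, ∃ a, r a = S.orderEmbOfFin hS p := fun p => by
    obtain ⟨a, -, ha⟩ := Finset.mem_map.1 (S.orderEmbOfFin_mem hS p)
    exact ⟨a, ha⟩
  choose e he using hmem
  have hinj : Function.Injective e := fun p q h => by
    have := congrArg r h
    rw [he, he] at this
    exact (S.orderEmbOfFin hS).injective this
  refine ⟨Equiv.ofBijective e ((Fintype.bijective_iff_injective_and_card e).2 ⟨hinj, by simp⟩),
    fun p q hpq => ?_⟩
  simp only [Equiv.ofBijective_apply, he]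
  exact (S.orderEmbOfFin hS).strictMono hpq

open scoped Classical in
/-- Laplace expansion: the sum over the permutations that contain a given partial matching is, up
to sign, the minor that is complementary to the matching. -/
theorem sum_perm_extending {E : Type*} [Fintype E] {N m : ℕ} (M : Matrix (Fin N) (Fin N) ℂ)
    (r c : E → Fin N) (hr : Function.Injective r) (hc : Function.Injective c)
    (f g : Fin m → Fin N) (hf : StrictMono f) (hg : StrictMono g)
    (hfr : Set.range f = (Set.range r)ᶜ) (hgc : Set.range g = (Set.range c)ᶜ) :
    ∑ σ : Equiv.Perm (Fin N) with (∀ e, σ (r e) = c e),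
      ((Equiv.Perm.sign σ : ℤ) : ℂ) * ∏ x ∈ (univ.image r)ᶜ, M x (σ x) =
    (∏ e, (-1 : ℂ) ^ ((r e : ℕ) + (c e : ℕ))) *
      (-1 : ℂ) ^ #{p : E × E | r p.1 < r p.2 ∧ c p.2 < c p.1} * (M.submatrix f g).det := by
  -- Replacing each contracted row by the unit row at its partner column makes the determinant
  -- select the permutations that contain the matching, with the contracted entries replaced by 1.
  let M' : Matrix (Fin N) (Fin N) ℂ := Matrix.of fun x y =>
    if x ∈ univ.image r then (if ∃ e, r e = x ∧ c e = y then 1 else 0) else M x y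
  have hdet : M'.det = ∑ σ : Equiv.Perm (Fin N) with (∀ e, σ (r e) = c e),
      ((Equiv.Perm.sign σ : ℤ) : ℂ) * ∏ x ∈ (univ.image r)ᶜ, M x (σ x) := by
    rw [det_eq_sum_row, Finset.sum_filter]
    refine Finset.sum_congr rfl fun σ _ => ?_
    rw [← Finset.prod_mul_prod_compl (univ.image r)]
    have h1 : ∏ x ∈ (univ.image r)ᶜ, M' x (σ x) = ∏ x ∈ (univ.image r)ᶜ, M x (σ x) :=
      Finset.prod_congr rfl fun x hx => if_neg (mem_compl.1 hx)
    rw [h1, Finset.prod_image fun _ _ _ _ h => hr h]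
    split_ifs with h
    · rw [Finset.prod_eq_one, one_mul]
      intro e _
      simp only [M', Matrix.of_apply]
      rw [if_pos (mem_image_of_mem r (mem_univ e)), if_pos ⟨e, rfl, (h e).symm⟩]
    · obtain ⟨e, he⟩ := not_forall.1 h
      rw [Finset.prod_eq_zero (mem_univ e), zero_mul, mul_zero]
      simp only [M', Matrix.of_apply]
      rw [if_pos (mem_image_of_mem r (mem_univ e)), if_neg]
      rintro ⟨e', h1, h2⟩
      rw [hr h1] at h2
      exact he h2.symm
  -- Sorting the pairs by row meets the monotonicity requirement of `det_delete_unit_rows`; the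
  -- inversion count does not depend on the labelling.
  obtain ⟨e, he⟩ := exists_equiv_strictMono r hr
  have hunit : ∀ p y, M' (r (e p)) y = if y = c (e p) then 1 else 0 := fun p y => by
    simp only [M', Matrix.of_apply]
    rw [if_pos (mem_image_of_mem r (mem_univ _))]
    refine if_congr ⟨?_, ?_⟩ rfl rfl
    · rintro ⟨e', h1, h2⟩
      rw [← h2, hr h1]
    · rintro rfl
      exact ⟨_, rfl, rfl⟩
  have hre : Set.range (fun p => r (e p)) = Set.range r := e.surjective.range_comp r
  have hce : Set.range (fun p => c (e p)) = Set.range c := e.surjective.range_comp c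
  have key := det_delete_unit_rows M' (fun p => r (e p)) (fun p => c (e p)) he
    (hc.comp e.injective) hunit f g hf hg (by rw [hre, hfr]) (by rw [hce, hgc])
  rw [← hdet, key]
  congr 1
  · congr 1
    · exact e.prod_comp fun a => (-1 : ℂ) ^ ((r a : ℕ) + (c a : ℕ))
    · rw [← Finset.prod_const, Finset.prod_filter, ← Finset.univ_product_univ,
        Finset.prod_product_right, ← e.prod_comp]
      refine Finset.prod_congr rfl fun q _ => ?_
      rw [← e.prod_comp]
      refine Finset.prod_congr rfl fun p _ => ?_
      refine if_congr ?_ rfl rfl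
      rw [he.lt_iff_lt]
  · congr 1
    ext a b
    simp only [Matrix.submatrix_apply, M', Matrix.of_apply]
    rw [if_neg]
    have : f a ∈ (Set.range r)ᶜ := hfr ▸ Set.mem_range_self a
    simpa using this

end Laplace

/-! ### Trees grown along an ordering of the vertices -/

section GrowingTrees

open Finset

/-- The parent is the neighbour of `v` on a shortest walk to `o`. -/
theorem exists_parent {V : Type*} {G : SimpleGraph V} (hG : G.Connected) {o v : V} (hv : v ≠ o) :
    ∃ u, G.Adj u v ∧ G.dist o v = G.dist o u + 1 := by
  obtain ⟨w, hw⟩ := hG.exists_walk_length_eq_dist v o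
  cases w with
  | nil => exact absurd rfl hv
  | @cons _ u _ h w =>
    refine ⟨u, h.symm, ?_⟩
    rw [SimpleGraph.Walk.length_cons] at hw
    have h1 := SimpleGraph.dist_le w
    have h2 : G.dist v o ≤ G.dist v u + G.dist u o := hG.dist_triangle
    rw [SimpleGraph.dist_eq_one_iff_adj.2 h] at h2
    rw [G.dist_comm (u := o) (v := v), G.dist_comm (u := o) (v := u)]
    omega

variable {n : ℕ}

/-- The graph in which the `(i+1)`-st vertex of the ordering `ω` is joined to the vertex at position
`p i`. -/
def growTree (ω : Equiv.Perm (Fin (n + 1))) (p : Fin n → Fin (n + 1)) : SimpleGraph (Fin (n + 1)) :=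
  SimpleGraph.fromRel fun u v => ∃ i : Fin n, u = ω i.succ ∧ v = ω (p i)

variable {ω : Equiv.Perm (Fin (n + 1))} {p : Fin n → Fin (n + 1)}

theorem lt_succ_of_le {i : Fin n} {j : Fin (n + 1)} (h : j ≤ i.castSucc) : j < i.succ :=
  lt_of_le_of_lt h i.castSucc_lt_succ

theorem growTree_adj (hp : ∀ i, p i ≤ i.castSucc) (i : Fin n) :
    (growTree ω p).Adj (ω i.succ) (ω (p i)) :=
  ⟨fun h => (lt_succ_of_le (hp i)).ne' (ω.injective h), Or.inl ⟨i, rfl, rfl⟩⟩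

theorem growTree_adj_iff (hp : ∀ i, p i ≤ i.castSucc) {i : Fin n} {j : Fin (n + 1)}
    (hj : j ≤ i.castSucc) : (growTree ω p).Adj (ω i.succ) (ω j) ↔ j = p i := by
  constructor
  · rintro ⟨-, ⟨k, h1, h2⟩ | ⟨k, h1, h2⟩⟩
    · rw [ω.injective.eq_iff, Fin.succ_inj] at h1
      rw [h1]
      exact ω.injective h2
    · have h1 := ω.injective h1
      have h2 := ω.injective h2
      have h3 := lt_succ_of_le (hp k)
      rw [← h1, ← h2] at h3
      exact absurd (lt_succ_of_le hj) h3.not_gt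
  · rintro rfl
    exact growTree_adj hp i

theorem growTree_connected (hp : ∀ i, p i ≤ i.castSucc) : (growTree ω p).Connected := by
  have h : ∀ j, (growTree ω p).Reachable (ω 0) (ω j) := by
    intro j
    induction j using WellFoundedLT.induction with
    | _ j ih =>
      rcases Fin.eq_zero_or_eq_succ j with rfl | ⟨i, rfl⟩
      · exact SimpleGraph.Reachable.refl _
      · exact (ih _ (lt_succ_of_le (hp i))).trans (growTree_adj hp i).symm.reachable
  refine { preconnected := fun u v => ?_, nonempty := inferInstance }
  have h1 := h (ω.symm u)
  have h2 := h (ω.symm v)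
  rw [Equiv.apply_symm_apply] at h1 h2
  exact h1.symm.trans h2

theorem growTree_pair_injective (hp : ∀ i, p i ≤ i.castSucc) {i k : Fin n}
    (h : s(ω i.succ, ω (p i)) = s(ω k.succ, ω (p k))) : i = k := by
  rw [Sym2.eq_iff] at h
  rcases h with ⟨h, -⟩ | ⟨h1, h2⟩
  · exact Fin.succ_injective _ (ω.injective h)
  · have h1 := ω.injective h1
    have h2 := ω.injective h2
    have h3 := lt_succ_of_le (hp i)
    have h4 := lt_succ_of_le (hp k)
    rw [← h1, ← h2] at h4
    exact absurd h3 h4.not_gt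

theorem growTree_isTree (hp : ∀ i, p i ≤ i.castSucc) : (growTree ω p).IsTree := by
  rw [SimpleGraph.isTree_iff_connected_and_card]
  refine ⟨growTree_connected hp, ?_⟩
  have : (growTree ω p).edgeSet = Set.range fun i => s(ω i.succ, ω (p i)) := by
    ext e
    induction e with
    | _ u v =>
      rw [SimpleGraph.mem_edgeSet]
      constructor
      · rintro ⟨-, ⟨k, rfl, rfl⟩ | ⟨k, rfl, rfl⟩⟩
        · exact ⟨k, rfl⟩
        · exact ⟨k, Sym2.eq_swap⟩
      · rintro ⟨i, hi⟩
        rw [← SimpleGraph.mem_edgeSet, ← hi]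
        exact growTree_adj hp i
  rw [this, Nat.card_range_of_injective fun i k h => growTree_pair_injective hp h]
  simp

/-- Induction on the distance `d`. A neighbour closer to the root that was attached later, to this
vertex, would by induction be farther from the root than this vertex. So the closer neighbour is the
attachment point. -/
theorem growTree_dist_lt (hp : ∀ i, p i ≤ i.castSucc) (hω : ω 0 = 0) (i : Fin n) :
    (growTree ω p).dist 0 (ω (p i)) < (growTree ω p).dist 0 (ω i.succ) := by
  generalize hd : (growTree ω p).dist 0 (ω i.succ) = d
  induction d using Nat.strong_induction_on generalizing i with
  | _ d ih =>
    have hne : ω i.succ ≠ 0 := fun h => by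
      rw [← hω] at h
      exact Fin.succ_ne_zero i (ω.injective h)
    obtain ⟨u, ⟨-, hu⟩, hdist⟩ := exists_parent (growTree_connected (ω := ω) hp) hne
    rcases hu with ⟨k, rfl, h2⟩ | ⟨k, h1, rfl⟩
    · have := ih _ (by omega) k rfl
      rw [← h2] at this
      omega
    · rw [ω.injective.eq_iff, Fin.succ_inj] at h1
      rw [h1] at hdist hd ⊢
      omega

theorem growTree_growing (hp : ∀ i, p i ≤ i.castSucc) (hω : ω 0 = 0) (u v : Fin (n + 1))
    (h : IsParent ⟨growTree ω p, growTree_isTree hp⟩ u v) : ω.symm u < ω.symm v := by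
  obtain ⟨⟨-, ⟨k, rfl, rfl⟩ | ⟨k, rfl, rfl⟩⟩, hd⟩ := h
  · have := growTree_dist_lt hp hω k
    simp only at hd
    omega
  · simp only [Equiv.symm_apply_apply]
    exact lt_succ_of_le (hp k)

/-- Attach every vertex to its parent in `T`. The result is a connected subgraph of `T`, hence all
of it, since a tree is minimally connected. -/
theorem exists_eq_growTree (hω : ω 0 = 0) (T : LabeledTree (n + 1))
    (hT : ∀ u v, IsParent T u v → ω.symm u < ω.symm v) :
    ∃ p : Fin n → Fin (n + 1), (∀ i, p i ≤ i.castSucc) ∧ growTree ω p = T.1 := by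
  have h : ∀ i : Fin n, ∃ u, IsParent T u (ω i.succ) := fun i => by
    refine exists_parent T.2.1 fun h => ?_
    rw [← hω] at h
    exact Fin.succ_ne_zero i (ω.injective h)
  choose u hu using h
  have hp : ∀ i, ω.symm (u i) ≤ i.castSucc := fun i => by
    have := hT _ _ (hu i)
    rw [Equiv.symm_apply_apply] at this
    exact Fin.le_castSucc_iff.2 this
  refine ⟨fun i => ω.symm (u i), hp, ?_⟩
  have hle : growTree ω (fun i => ω.symm (u i)) ≤ T.1 := by
    intro a b hab
    obtain ⟨-, ⟨k, rfl, rfl⟩ | ⟨k, rfl, rfl⟩⟩ := hab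
    · rw [Equiv.apply_symm_apply]; exact (hu k).1.symm
    · rw [Equiv.apply_symm_apply]; exact (hu k).1
  exact le_antisymm hle
    ((SimpleGraph.isTree_iff_minimal_connected.1 T.2).2 (growTree_connected hp) hle)

theorem growTree_injective {q : Fin n → Fin (n + 1)} (hp : ∀ i, p i ≤ i.castSucc)
    (hq : ∀ i, q i ≤ i.castSucc) (h : growTree ω p = growTree ω q) : p = q := by
  funext i
  have := growTree_adj (ω := ω) hp i
  rwa [h, growTree_adj_iff hq (hp i)] at this

theorem prod_edges_growTree (hp : ∀ i, p i ≤ i.castSucc) (F : Fin (n + 1) → Fin (n + 1) → ℂ)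
    (hF : ∀ u v, F u v = F v u) :
    ∏ e : Edge ⟨growTree ω p, growTree_isTree hp⟩, F e.1.1 e.1.2 =
      ∏ i, F (ω i.succ) (ω (p i)) := by
  have hlt : ∀ i, ¬ ω i.succ < ω (p i) → ω (p i) < ω i.succ := fun i h =>
    lt_of_le_of_ne (not_lt.1 h) (growTree_adj hp i).ne'
  let φ : Fin n → Edge ⟨growTree ω p, growTree_isTree hp⟩ := fun i =>
    if h : ω i.succ < ω (p i) then ⟨(ω i.succ, ω (p i)), h, growTree_adj hp i⟩
    else ⟨(ω (p i), ω i.succ), hlt i h, (growTree_adj hp i).symm⟩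
  have hφ : ∀ i, s((φ i).1.1, (φ i).1.2) = s(ω i.succ, ω (p i)) := fun i => by
    simp only [φ]
    split_ifs
    · rfl
    · exact Sym2.eq_swap
  have hφF : ∀ i, F (φ i).1.1 (φ i).1.2 = F (ω i.succ) (ω (p i)) := fun i => by
    rcases Sym2.eq_iff.1 (hφ i) with ⟨h1, h2⟩ | ⟨h1, h2⟩
    · rw [h1, h2]
    · rw [h1, h2, hF]
  have hbij : Function.Bijective φ := by
    constructor
    · intro i k h
      apply growTree_pair_injective (ω := ω) hp
      rw [← hφ, ← hφ, h]
    · rintro ⟨⟨u, v⟩, huv, -, ⟨k, h1, h2⟩ | ⟨k, h1, h2⟩⟩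
      · refine ⟨k, ?_⟩
        simp only at h1 h2 huv
        subst h1 h2
        simp only [φ, dif_pos huv]
      · refine ⟨k, ?_⟩
        simp only at h1 h2 huv
        subst h1 h2
        simp only [φ, dif_neg huv.not_gt]
  rw [← hbij.prod_comp]
  exact Finset.prod_congr rfl fun i _ => hφF i

open scoped Classical in
-- For fixed `ω`, compatible trees correspond to independent choices of an earlier attachment point
-- for each non-root vertex, so the sum factorises.
theorem sum_growing_trees (hω : ω 0 = 0) (F : Fin (n + 1) → Fin (n + 1) → ℂ)
    (hF : ∀ u v, F u v = F v u) :
    ∑ T : LabeledTree (n + 1) with (∀ u v, IsParent T u v → ω.symm u < ω.symm v),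
      ∏ e : Edge T, F e.1.1 e.1.2 =
    ∏ i : Fin n, ∑ j ∈ Finset.Iic i.castSucc, F (ω i.succ) (ω j) := by
  rw [Finset.prod_univ_sum]
  have hmem : ∀ p ∈ Fintype.piFinset fun i : Fin n => Finset.Iic i.castSucc,
      ∀ i, p i ≤ i.castSucc := fun p hp i => by simpa using Fintype.mem_piFinset.1 hp i
  symm
  refine Finset.sum_bij (fun p hp => ⟨growTree ω p, growTree_isTree (hmem p hp)⟩) ?_ ?_ ?_ ?_
  · intro p hp
    rw [mem_filter]
    exact ⟨mem_univ _, growTree_growing (hmem p hp) hω⟩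
  · intro p hp q hq h
    exact growTree_injective (hmem p hp) (hmem q hq) (congrArg Subtype.val h)
  · intro T hT
    obtain ⟨p, hp, h⟩ := exists_eq_growTree hω T (mem_filter.1 hT).2
    exact ⟨p, Fintype.mem_piFinset.2 fun i => by simpa using hp i, Subtype.ext h⟩
  · intro p hp
    exact (prod_edges_growTree (hmem p hp) F hF).symm

end GrowingTrees

/-! ### Summation over growing paths -/

section Paths

open Finset

/-- Total probability of an `n`-step process whose transitions depend on the set visited so far, by
conditioning on the first step. The size bound matters: transitions out of the full vertex set need
not sum to 1. -/
theorem sum_prod_history {V : Type*} [Fintype V] [DecidableEq V] (g : Finset V → V → ℂ) (n : ℕ) :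
    ∀ S : Finset V, (∀ S', S ⊆ S' → #S' < #S + n → ∑ v, g S' v = 1) →
      ∑ u : Fin n → V, ∏ i, g (S ∪ (Finset.Iio i).image u) (u i) = 1 := by
  induction n with
  | zero => intro S _; simp
  | succ n ih =>
    intro S hS
    rw [← (Fin.consEquiv fun _ : Fin (n + 1) => V).sum_comp, Fintype.sum_prod_type]
    have key : ∀ (v : V) (u : Fin n → V),
        ∏ i, g (S ∪ (Finset.Iio i).image (Fin.consEquiv (fun _ => V) (v, u)))
          (Fin.consEquiv (fun _ => V) (v, u) i) =
        g S v * ∏ i, g (insert v S ∪ (Finset.Iio i).image u) (u i) := by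
      intro v u
      rw [Fin.prod_univ_succ]
      congr 1
      · have h0 : Finset.Iio (0 : Fin (n + 1)) = ∅ := by ext i; simp
        simp [Fin.consEquiv, h0]
      · refine Finset.prod_congr rfl fun i _ => ?_
        congr 1
        ext w
        simp only [Fin.consEquiv, Equiv.coe_fn_mk, mem_union, mem_image, mem_Iio, mem_insert,
          Fin.exists_fin_succ, Fin.cons_zero, Fin.cons_succ, Fin.succ_pos, true_and,
          Fin.succ_lt_succ_iff]
        tauto
    simp only [key, ← Finset.mul_sum]
    rw [← hS S subset_rfl (by omega)]
    refine Finset.sum_congr rfl fun v _ => ?_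
    rw [ih (insert v S), mul_one]
    intro S' hS' hc
    refine hS S' ((subset_insert _ _).trans hS') ?_
    have := card_insert_le v S
    omega

/-! ### Links crossing a cut and random growth -/

variable {X : Type*} [Fintype X]

section Links

variable {V : Type*} [DecidableEq V] (blk : X → V) (σ : Equiv.Perm X)

/-- The number of links between `v` and `w` in the permutation `σ`. -/
def linkCount (v w : V) : ℕ :=
  #{x | (blk x = v ∧ blk (σ x) = w) ∨ (blk x = w ∧ blk (σ x) = v)}

theorem linkCount_comm (v w : V) : linkCount blk σ v w = linkCount blk σ w v := by
  unfold linkCount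
  congr 1
  ext x
  simp only [mem_filter, mem_univ, true_and]
  tauto

end Links

variable {n : ℕ} (blk : X → Fin (n + 1)) (σ : Equiv.Perm X)

/-- The number of links of the permutation `σ` that cross `S`. -/
def crossCount (S : Finset (Fin (n + 1))) : ℕ := #{x | Crosses S (blk x) (blk (σ x))}

/-- Each crossing link has one endpoint outside `S` and one inside; `f` records them in this order.
-/
theorem crossCount_eq (S : Finset (Fin (n + 1))) :
    crossCount blk σ S = ∑ v ∈ Sᶜ, ∑ y ∈ S, linkCount blk σ v y := by
  rw [← Finset.sum_product']
  let f : X → Fin (n + 1) × Fin (n + 1) := fun x =>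
    if blk x ∈ S then (blk (σ x), blk x) else (blk x, blk (σ x))
  rw [crossCount, Finset.card_eq_sum_card_fiberwise (f := f) (t := Sᶜ ×ˢ S)]
  · refine Finset.sum_congr rfl fun p hp => ?_
    rw [mem_product, mem_compl] at hp
    unfold linkCount
    congr 1
    ext x
    simp only [mem_filter, mem_univ, true_and, f]
    simp only [Crosses]
    obtain ⟨v, y⟩ := p
    simp only at hp
    split_ifs with h
    · simp only [Prod.mk.injEq]
      constructor
      · rintro ⟨-, rfl, rfl⟩; simp
      · rintro (⟨rfl, rfl⟩ | ⟨rfl, rfl⟩)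
        · exact absurd h hp.1
        · simp [hp.1, hp.2]
    · simp only [Prod.mk.injEq]
      constructor
      · rintro ⟨-, rfl, rfl⟩; simp
      · rintro (⟨rfl, rfl⟩ | ⟨rfl, rfl⟩)
        · simp [hp.1, hp.2]
        · exact absurd hp.2 h
  · intro x hx
    rw [mem_coe, mem_filter] at hx
    replace hx := hx.2
    simp only [Crosses] at hx
    simp only [f, mem_coe, mem_product, mem_compl]
    rcases hx with ⟨h1, h2⟩ | ⟨h1, h2⟩
    · simp [h1, h2]
    · simp [h1, h2]

variable {blk σ}

theorem exists_adj_crosses {G : SimpleGraph (Fin (n + 1))} (hG : G.Connected)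
    {S : Finset (Fin (n + 1))} {a b : Fin (n + 1)} (ha : a ∈ S) (hb : b ∉ S) :
    ∃ u v, G.Adj u v ∧ Crosses S u v := by
  obtain ⟨w⟩ := hG.preconnected a b
  obtain ⟨d, -, h1, h2⟩ := w.exists_boundary_dart S (by simpa using ha) (by simpa using hb)
  exact ⟨d.fst, d.snd, d.adj, Or.inl ⟨by simpa using h1, by simpa using h2⟩⟩

theorem crosses_comm {S : Finset (Fin (n + 1))} {u v : Fin (n + 1)} :
    Crosses S u v ↔ Crosses S v u := by
  unfold Crosses; tauto

theorem crossCount_pos (h : (linkGraph blk σ).Connected) {S : Finset (Fin (n + 1))}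
    {a b : Fin (n + 1)} (ha : a ∈ S) (hb : b ∉ S) : 0 < crossCount blk σ S := by
  obtain ⟨u, v, ⟨-, ⟨x, rfl, rfl⟩ | ⟨x, rfl, rfl⟩⟩, hc⟩ := exists_adj_crosses h ha hb
  · exact card_pos.2 ⟨x, by simpa using hc⟩
  · exact card_pos.2 ⟨x, by simpa using crosses_comm.1 hc⟩

theorem visited_eq (ω : Equiv.Perm (Fin (n + 1))) (hω : ω 0 = 0) (i : Fin n) :
    visited ω i = {0} ∪ (Finset.Iio i).image fun j => ω j.succ := by
  ext w
  simp only [visited, mem_image, mem_Iic, mem_union, mem_singleton, mem_Iio, Fin.exists_fin_succ,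
    hω, Fin.zero_le, true_and]
  refine or_congr eq_comm (exists_congr fun j => and_congr_left fun _ => ?_)
  rw [Fin.succ_le_castSucc_iff]

open scoped Classical in
/-- Growing a path by choosing each time a uniformly random crossing link is a probability
distribution if the links are connected. -/
theorem sum_growing_paths (h : (linkGraph blk σ).Connected) :
    ∑ ω : Equiv.Perm (Fin (n + 1)) with ω 0 = 0, ∏ i : Fin n,
      (∑ j ∈ Finset.Iic i.castSucc, (linkCount blk σ (ω i.succ) (ω j) : ℂ)) /
        (crossCount blk σ (visited ω i) : ℂ) = 1 := by
  -- The probability that the next vertex is `v`: the share of crossing links ending at `v`. Visited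
  -- vertices get 0, so that sums over all sequences reduce to orderings.
  let g : Finset (Fin (n + 1)) → Fin (n + 1) → ℂ := fun S v =>
    if v ∈ S then 0 else (∑ y ∈ S, (linkCount blk σ v y : ℂ)) / (crossCount blk σ S : ℂ)
  have hsum := sum_prod_history g n {0} (by
    intro S hS hcard
    have h0 : 0 ∈ S := hS (mem_singleton_self 0)
    obtain ⟨b, hb⟩ : ∃ b, b ∉ S := by
      by_contra hall
      push Not at hall
      rw [eq_univ_of_forall hall, card_univ, Fintype.card_fin, card_singleton] at hcard
      omega
    have hpos := crossCount_pos h h0 hb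
    simp only [g]
    rw [← Finset.sum_filter_add_sum_filter_not univ (· ∈ S), Finset.sum_eq_zero, zero_add]
    · have : (univ.filter fun v => v ∉ S) = Sᶜ := by ext; simp
      rw [this, Finset.sum_congr rfl fun v hv => if_neg (mem_compl.1 hv), ← Finset.sum_div]
      rw [div_eq_one_iff_eq (by exact_mod_cast hpos.ne'), crossCount_eq]
      push_cast
      rfl
    · intro v hv
      rw [if_pos (mem_filter.1 hv).2])
  rw [← hsum]
  refine Finset.sum_of_injOn (fun ω i => ω i.succ) ?_ (fun _ _ => mem_coe.2 (mem_univ _)) ?_ ?_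
  · intro ω hω ω' hω' he
    simp only [coe_filter, mem_univ, true_and] at hω hω'
    ext1 j
    rcases Fin.eq_zero_or_eq_succ j with rfl | ⟨i, rfl⟩
    · exact hω.trans (Eq.symm hω')
    · exact congrFun he i
  -- A sequence of nonzero weight never repeats a vertex or returns to the root, so prefixing the
  -- root gives a permutation.
  · intro u _ hu
    by_contra hne
    refine hu ?_
    rw [← ne_eq, Finset.prod_ne_zero_iff] at hne
    have hu' : ∀ i, u i ∉ ({0} ∪ (Finset.Iio i).image u : Finset (Fin (n + 1))) := fun i hi =>
      hne i (mem_univ i) (if_pos hi)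
    have hlt : ∀ i j, i < j → u i ≠ u j := fun i j hij e =>
      hu' j (mem_union_right _ (mem_image.2 ⟨i, mem_Iio.2 hij, e⟩))
    have hinj : Function.Injective (Fin.cons 0 u : Fin (n + 1) → Fin (n + 1)) := by
      rw [Fin.cons_injective_iff]
      refine ⟨?_, fun i j e => ?_⟩
      · rintro ⟨i, hi⟩
        exact hu' i (mem_union_left _ (by simp [hi]))
      · by_contra hij
        rcases lt_or_gt_of_ne hij with hij | hij
        · exact hlt i j hij e
        · exact hlt j i hij e.symm
    refine ⟨Equiv.ofBijective _ (Finite.injective_iff_bijective.1 hinj), ?_, ?_⟩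
    · simp
    · funext i
      simp
  · intro ω hω
    have hω0 : ω 0 = 0 := by simpa using hω
    refine Finset.prod_congr rfl fun i _ => ?_
    have hv := visited_eq ω hω0 i
    rw [← hv]
    have hni : ω i.succ ∉ visited ω i := by
      simp only [visited, mem_image, mem_Iic, not_exists, not_and]
      intro j hj e
      exact (lt_succ_of_le hj).ne (ω.injective e)
    simp only [g]
    rw [if_neg hni, visited, Finset.sum_image fun _ _ _ _ e => ω.injective e]

open MeasureTheory in
theorem integral_unitCube_prod_pow (k : Fin n → ℕ) :
    ∫ t in Set.Icc (0 : Fin n → ℝ) 1, ∏ i, ((t i : ℝ) : ℂ) ^ k i = ∏ i, (1 / (k i + 1) : ℂ) := by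
  have hI : Set.Icc (0 : Fin n → ℝ) 1 = Set.pi Set.univ fun _ => Set.Icc (0 : ℝ) 1 :=
    (Set.pi_univ_Icc _ _).symm
  rw [hI, volume_pi, Measure.restrict_pi_pi,
    integral_fintype_prod_eq_prod (fun i (x : ℝ) => (x : ℂ) ^ k i)]
  refine Finset.prod_congr rfl fun i _ => ?_
  rw [integral_Icc_eq_integral_Ioc, ← intervalIntegral.integral_of_le zero_le_one]
  simp only [← Complex.ofReal_pow]
  rw [intervalIntegral.integral_ofReal, integral_pow]
  simp

end Paths

/-! ### Contraction assignments contained in a permutation -/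

section Assignments

open Finset

variable {Ω : Type*} {n : ℕ} {P : Fin (n + 1) → Interaction Ω} {T : LabeledTree (n + 1)}

/-- The block of a row or column number. -/
def block (P : Fin (n + 1) → Interaction Ω) (x : Fin (∑ i, (P i).m)) : Fin (n + 1) :=
  (finSigmaFinEquiv.symm x).1

theorem block_row (χ : Assignment P T) (e : Edge T) : block P (row χ e) = (annihLeg χ.1 e).1 := by
  rw [block, row, pos, Equiv.symm_apply_apply]

theorem block_col (χ : Assignment P T) (e : Edge T) : block P (col χ e) = (creatLeg χ.1 e).1 := by
  rw [block, col, pos, Equiv.symm_apply_apply]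

theorem row_injective (χ : Assignment P T) : Function.Injective (row χ) :=
  finSigmaFinEquiv.injective.comp χ.2.1

theorem col_injective (χ : Assignment P T) : Function.Injective (col χ) :=
  finSigmaFinEquiv.injective.comp χ.2.2

theorem block_row_col (χ : Assignment P T) (e : Edge T) :
    (block P (row χ e) = e.1.1 ∧ block P (col χ e) = e.1.2) ∨
      (block P (row χ e) = e.1.2 ∧ block P (col χ e) = e.1.1) := by
  rw [block_row, block_col, annihLeg, creatLeg]
  split_ifs
  · exact Or.inr ⟨rfl, rfl⟩
  · exact Or.inl ⟨rfl, rfl⟩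

theorem edge_eq_of_pair {e e' : Edge T} {a b : Fin (n + 1)}
    (h : (a = e.1.1 ∧ b = e.1.2) ∨ (a = e.1.2 ∧ b = e.1.1))
    (h' : (a = e'.1.1 ∧ b = e'.1.2) ∨ (a = e'.1.2 ∧ b = e'.1.1)) : e = e' := by
  have l := e.2.1
  have l' := e'.2.1
  apply Subtype.ext
  rcases h with ⟨h1, h2⟩ | ⟨h1, h2⟩ <;> rcases h' with ⟨h3, h4⟩ | ⟨h3, h4⟩
  · exact Prod.ext (h1.symm.trans h3) (h2.symm.trans h4)
  · rw [← h1, ← h2] at l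
    rw [← h3, ← h4] at l'
    exact absurd l l'.not_gt
  · rw [← h1, ← h2] at l
    rw [← h3, ← h4] at l'
    exact absurd l l'.not_gt
  · exact Prod.ext (h2.symm.trans h4) (h1.symm.trans h3)

open scoped Classical in
-- An assignment inside `σ` is a choice, for each edge, of a link of `σ` between its endpoints. The
-- direction of the link determines the orientation sign because the endpoints differ, and no
-- operator is used twice because a link determines its edge.
theorem card_assignments (T : LabeledTree (n + 1)) (σ : Equiv.Perm (Fin (∑ i, (P i).m))) :
    #{χ : Assignment P T | ∀ e, σ (row χ e) = col χ e} =
      ∏ e : Edge T, linkCount (block P) σ e.1.1 e.1.2 := by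
  let L : Edge T → Type := fun e => {x : Fin (∑ i, (P i).m) //
    (block P x = e.1.1 ∧ block P (σ x) = e.1.2) ∨ (block P x = e.1.2 ∧ block P (σ x) = e.1.1)}
  let Φ : {χ : Assignment P T // ∀ e, σ (row χ e) = col χ e} → ∀ e, L e := fun χ e =>
    ⟨row χ.1 e, by rw [χ.2 e]; exact block_row_col χ.1 e⟩
  have hinj : Function.Injective Φ := by
    rintro ⟨χ, hχ⟩ ⟨χ', hχ'⟩ h
    have hrow : ∀ e, row χ e = row χ' e := fun e => congrArg Subtype.val (congrFun h e)
    have ha : ∀ e, annihLeg χ.1 e = annihLeg χ'.1 e := fun e =>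
      finSigmaFinEquiv.injective (hrow e)
    have hc : ∀ e, creatLeg χ.1 e = creatLeg χ'.1 e := fun e =>
      finSigmaFinEquiv.injective (by
        change col χ e = col χ' e
        rw [← hχ, ← hχ', hrow])
    have : χ.1 = χ'.1 := by
      funext e
      have ha := ha e
      have hc := hc e
      have hne := e.2.1.ne
      rw [annihLeg, annihLeg] at ha
      rw [creatLeg, creatLeg] at hc
      revert ha hc
      generalize χ.1 e = z
      generalize χ'.1 e = z'
      obtain ⟨s, k, l⟩ := z
      obtain ⟨s', k', l'⟩ := z'
      intro ha hc
      rcases Int.units_eq_one_or s with rfl | rfl <;>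
        rcases Int.units_eq_one_or s' with rfl | rfl
      · simp only [if_true, Sigma.mk.injEq, heq_eq_eq, true_and] at ha hc
        rw [ha, hc]
      · simp [hne] at hc
      · simp [hne] at ha
      · simp at ha hc
        rw [ha, hc]
    exact Subtype.ext (Subtype.ext this)
  have hsurj : Function.Surjective Φ := by
    intro x
    have aux : ∀ (i j : Fin (n + 1)) (a b : (i : Fin (n + 1)) × Fin (P i).m),
        ((a.1 = i ∧ b.1 = j) ∨ (a.1 = j ∧ b.1 = i)) →
        ∃ c : ℤˣ × Fin (P i).m × Fin (P j).m,
          (if c.1 = 1 then (⟨j, c.2.2⟩ : (i : Fin (n + 1)) × Fin (P i).m) else ⟨i, c.2.1⟩) = a ∧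
          (if c.1 = 1 then (⟨i, c.2.1⟩ : (i : Fin (n + 1)) × Fin (P i).m) else ⟨j, c.2.2⟩) = b := by
      rintro i j ⟨a, k⟩ ⟨b, l⟩ (⟨rfl, rfl⟩ | ⟨rfl, rfl⟩)
      · exact ⟨(-1, k, l), by simp⟩
      · exact ⟨(1, l, k), by simp⟩
    choose c hc1 hc2 using fun e : Edge T => aux e.1.1 e.1.2 (finSigmaFinEquiv.symm (x e).1)
      (finSigmaFinEquiv.symm (σ (x e).1)) (x e).2
    have h1 : ∀ e, finSigmaFinEquiv (annihLeg (P := P) (T := T) c e) = (x e).1 := fun e => by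
      rw [← Equiv.eq_symm_apply]; exact hc1 e
    have h2 : ∀ e, finSigmaFinEquiv (creatLeg (P := P) (T := T) c e) = σ (x e).1 := fun e => by
      rw [← Equiv.eq_symm_apply]; exact hc2 e
    have hx : ∀ e e', (x e).1 = (x e').1 → e = e' := fun e e' he => by
      have := (x e).2
      rw [he] at this
      exact edge_eq_of_pair this (x e').2
    refine ⟨⟨⟨c, fun e e' he => hx e e' ?_, fun e e' he => hx e e' (σ.injective ?_)⟩,
      fun e => ?_⟩, ?_⟩
    · rw [← h1, ← h1, he]
    · rw [← h2, ← h2, he]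
    · change σ (finSigmaFinEquiv (annihLeg c e)) = finSigmaFinEquiv (creatLeg c e)
      rw [h1, h2]
    · funext e
      exact Subtype.ext (h1 e)
  rw [← Fintype.card_subtype, Fintype.card_of_bijective ⟨hinj, hsurj⟩, Fintype.card_pi]
  refine Finset.prod_congr rfl fun e _ => ?_
  rw [Fintype.card_subtype]
  unfold linkCount
  congr

/-! ### The integral over the interpolation parameters -/

/-- The visited set is a proper nonempty subset and the tree is connected; hence the subtraction in
`b_i - 1` is never truncated. -/
theorem crossingNumber_pos (T : LabeledTree (n + 1)) (ω : Equiv.Perm (Fin (n + 1))) (i : Fin n) :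
    0 < crossingNumber T ω i := by
  have ha : ω 0 ∈ visited ω i := mem_image_of_mem _ (mem_Iic.2 (Fin.zero_le _))
  have hb : ω (Fin.last n) ∉ visited ω i := by
    simp only [visited, mem_image, mem_Iic, not_exists, not_and]
    intro j hj e
    rw [ω.injective e] at hj
    exact absurd hj (Fin.castSucc_lt_last i).not_ge
  obtain ⟨u, v, hadj, hc⟩ := exists_adj_crosses T.2.1 ha hb
  rcases lt_or_gt_of_ne hadj.ne with h | h
  · exact card_pos.2 ⟨⟨(u, v), h, hadj⟩, by simpa using hc⟩
  · exact card_pos.2 ⟨⟨(v, u), h, hadj.symm⟩, by simpa using crosses_comm.1 hc⟩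

theorem crossCount_eq_add (χ : Assignment P T) {σ : Equiv.Perm (Fin (∑ i, (P i).m))}
    (hσ : ∀ e, σ (row χ e) = col χ e) (ω : Equiv.Perm (Fin (n + 1))) (i : Fin n) :
    crossCount (block P) σ (visited ω i) =
      #{x ∈ freeRows χ | Crosses (visited ω i) (block P x) (block P (σ x))} +
        crossingNumber T ω i := by
  have h1 : crossingNumber T ω i = #{x ∈ univ.image (row χ) |
      Crosses (visited ω i) (block P x) (block P (σ x))} := by
    rw [Finset.filter_image, Finset.card_image_of_injective _ (row_injective χ), crossingNumber]
    congr 1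
    ext e
    simp only [mem_filter, mem_univ, true_and, hσ]
    rcases block_row_col χ e with ⟨h1, h2⟩ | ⟨h1, h2⟩
    · rw [h1, h2]
    · rw [h1, h2, crosses_comm]
  rw [h1, crossCount, freeRows, ← Finset.card_union_of_disjoint, ← Finset.filter_union]
  · congr 2
    rw [Finset.union_comm, Finset.union_compl]
  · exact Finset.disjoint_filter_filter (Finset.disjoint_left.2 fun x hx => mem_compl.1 hx)

/-- The density contributes `b_i - 1` to the exponent of `t_i`, and each uncontracted crossing link
contributes 1. The contracted crossing links number `b_i`, so the exponent is one less than the full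
crossing count, whatever `T` and `χ` are. -/
theorem integral_pathDensity_mul_weights (χ : Assignment P T)
    {σ : Equiv.Perm (Fin (∑ i, (P i).m))} (hσ : ∀ e, σ (row χ e) = col χ e)
    (ω : Equiv.Perm (Fin (n + 1))) :
    ∫ t in Set.Icc (0 : Fin n → ℝ) 1, (pathDensity T ω t : ℂ) *
      ∏ x ∈ freeRows χ, (weight ω t (block P x) (block P (σ x)) : ℂ) =
    ∏ i, (1 / crossCount (block P) σ (visited ω i) : ℂ) := by
  have hprod : ∀ t : Fin n → ℝ, (pathDensity T ω t : ℂ) *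
      ∏ x ∈ freeRows χ, (weight ω t (block P x) (block P (σ x)) : ℂ) =
      ∏ i, ((t i : ℝ) : ℂ) ^ (crossCount (block P) σ (visited ω i) - 1) := by
    intro t
    simp only [pathDensity, weight, Complex.ofReal_prod, Complex.ofReal_pow, Finset.prod_filter,
      apply_ite Complex.ofReal, Complex.ofReal_one]
    rw [Finset.prod_comm, ← Finset.prod_mul_distrib]
    refine Finset.prod_congr rfl fun i _ => ?_
    rw [← Finset.prod_filter, Finset.prod_const, ← pow_add, crossCount_eq_add χ hσ ω i]
    congr 1
    have := crossingNumber_pos T ω i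
    omega
  simp only [hprod]
  rw [integral_unitCube_prod_pow]
  refine Finset.prod_congr rfl fun i _ => ?_
  have : 1 ≤ crossCount (block P) σ (visited ω i) := by
    rw [crossCount_eq_add χ hσ ω i]
    have := crossingNumber_pos T ω i
    omega
  rw [Nat.cast_sub this]
  simp

/-! ### The sum over trees and growing paths -/

/-- If every edge of `T` carried a link, the link graph would contain `T` and be connected. -/
theorem prod_linkCount_eq_zero (T : LabeledTree (n + 1)) {X : Type*} [Fintype X]
    {blk : X → Fin (n + 1)} {σ : Equiv.Perm X} (h : ¬ (linkGraph blk σ).Connected) :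
    ∏ e : Edge T, linkCount blk σ e.1.1 e.1.2 = 0 := by
  by_contra hne
  rw [← ne_eq, Finset.prod_ne_zero_iff] at hne
  refine h (T.2.1.mono ?_)
  have key : ∀ u v, u < v → T.1.Adj u v → (linkGraph blk σ).Adj u v := by
    intro u v huv hadj
    obtain ⟨x, hx⟩ := card_pos.1 (Nat.pos_of_ne_zero (hne ⟨(u, v), huv, hadj⟩ (mem_univ _)))
    rw [mem_filter] at hx
    rcases hx.2 with hx | hx
    · exact ⟨huv.ne, Or.inl ⟨x, hx⟩⟩
    · exact ⟨huv.ne, Or.inr ⟨x, hx⟩⟩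
  intro u v hadj
  rcases lt_or_gt_of_ne hadj.ne with huv | huv
  · exact key u v huv hadj
  · exact (key v u huv hadj.symm).symm

open scoped Classical in
-- Exchange the sums: for fixed `ω`, the sum over compatible trees factorises into the transition
-- probabilities of the growth process.
theorem sum_trees_growingPaths {X : Type*} [Fintype X] (blk : X → Fin (n + 1))
    (σ : Equiv.Perm X) :
    ∑ T : LabeledTree (n + 1), (∏ e : Edge T, (linkCount blk σ e.1.1 e.1.2 : ℂ)) *
      ∑ ω : GrowingPath T, ∏ i, (1 / crossCount blk σ (visited ω.1 i) : ℂ) =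
    if (linkGraph blk σ).Connected then 1 else 0 := by
  split_ifs with h
  · have hω : ∀ T : LabeledTree (n + 1),
        ∑ ω : GrowingPath T, ∏ i, (1 / crossCount blk σ (visited ω.1 i) : ℂ) =
        ∑ ω : Equiv.Perm (Fin (n + 1)) with ω 0 = 0,
          if (∀ u v, IsParent T u v → ω.symm u < ω.symm v) then
            ∏ i, (1 / crossCount blk σ (visited ω i) : ℂ) else 0 := by
      intro T
      rw [← Finset.sum_filter, Finset.filter_filter]
      symm
      refine Finset.sum_subtype _ (fun ω => ?_) _
      simp
    simp only [hω, Finset.mul_sum]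
    rw [Finset.sum_comm]
    refine Eq.trans ?_ (sum_growing_paths h)
    refine Finset.sum_congr rfl fun ω hω0 => ?_
    have hω0 : ω 0 = 0 := by simpa using hω0
    simp only [Finset.prod_div_distrib, Finset.prod_const_one]
    rw [← sum_growing_trees hω0 (fun u v => (linkCount blk σ u v : ℂ))
      (fun u v => by rw [linkCount_comm]), Finset.sum_filter, Finset.sum_div]
    refine Finset.sum_congr rfl fun T _ => ?_
    split_ifs
    · rw [mul_one_div]
    · simp
  · refine Finset.sum_eq_zero fun T _ => ?_
    rw [← Nat.cast_prod, prod_linkCount_eq_zero T h, Nat.cast_zero, zero_mul]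

open scoped Classical in
/-- The total weight of a permutation in the tree expansion. -/
theorem sum_trees_integral (σ : Equiv.Perm (Fin (∑ i, (P i).m))) :
    ∑ T : LabeledTree (n + 1), ∑ χ : Assignment P T with (∀ e, σ (row χ e) = col χ e),
      ∑ ω : GrowingPath T, ∫ t in Set.Icc (0 : Fin n → ℝ) 1, (pathDensity T ω.1 t : ℂ) *
        ∏ x ∈ freeRows χ, (weight ω.1 t (block P x) (block P (σ x)) : ℂ) =
    if (linkGraph (block P) σ).Connected then 1 else 0 := by
  rw [← sum_trees_growingPaths]
  refine Finset.sum_congr rfl fun T _ => ?_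
  rw [Finset.sum_congr rfl fun χ hχ => Finset.sum_congr rfl fun ω _ =>
    integral_pathDensity_mul_weights χ (mem_filter.1 hχ).2 ω.1, Finset.sum_const, card_assignments,
    nsmul_eq_mul, Nat.cast_prod]

end Assignments

/-! ### Assembling the expansion -/

section Assembly

open Finset

/-! ### Signs of the complementary minors -/

section Signs

variable {Ω : Type*} {n : ℕ} {P : Fin (n + 1) → Interaction Ω} {T : LabeledTree (n + 1)}

theorem val_pos (P : Fin (n + 1) → Interaction Ω) (x : (i : Fin (n + 1)) × Fin (P i).m) :
    (pos P x : ℕ) = (∑ r ∈ Finset.Iio x.1, (P r).m) + (x.2 : ℕ) := by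
  rw [pos, finSigmaFinEquiv_apply]
  congr 1
  refine Finset.sum_bij (fun i _ => Fin.castLE x.1.2.le i) ?_ ?_ ?_ ?_
  · intro i _
    rw [mem_Iio, Fin.lt_def]
    exact i.2
  · intro i _ j _ h
    exact Fin.castLE_injective _ h
  · intro r hr
    exact ⟨⟨r, Fin.lt_def.1 (mem_Iio.1 hr)⟩, mem_univ _, rfl⟩
  · intro i _
    rfl

theorem neg_one_pow_row_add_col (χ : Assignment P T) (e : Edge T) :
    (-1 : ℂ) ^ ((row χ e : ℕ) + (col χ e : ℕ)) = ((edgeSign χ e : ℤ) : ℂ) := by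
  rw [row, col, edgeSign]
  push_cast
  congr 1
  by_cases hs : (χ.1 e).1 = 1
  · rw [show annihLeg χ.1 e = ⟨e.1.2, (χ.1 e).2.2⟩ from if_pos hs,
      show creatLeg χ.1 e = ⟨e.1.1, (χ.1 e).2.1⟩ from if_pos hs, val_pos, val_pos]
    ring
  · rw [show annihLeg χ.1 e = ⟨e.1.1, (χ.1 e).2.1⟩ from if_neg hs,
      show creatLeg χ.1 e = ⟨e.1.2, (χ.1 e).2.2⟩ from if_neg hs, val_pos, val_pos]
    ring

open scoped Classical in
/-- The complementary minor with its sign is the sum over the permutations that contain the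
contraction assignment. -/
theorem sign_mul_det_minor (χ : Assignment P T)
    (M : Matrix (Fin (∑ i, (P i).m)) (Fin (∑ i, (P i).m)) ℂ) :
    (((∏ e, edgeSign χ e) * matchingSign χ : ℤˣ) : ℤ) * (M.submatrix
      ((freeRows χ).orderEmbOfFin rfl) ((freeCols χ).orderEmbOfFin (card_freeCols χ))).det =
    ∑ σ : Equiv.Perm (Fin (∑ i, (P i).m)) with (∀ e, σ (row χ e) = col χ e),
      ((Equiv.Perm.sign σ : ℤ) : ℂ) * ∏ x ∈ freeRows χ, M x (σ x) := by
  have h := sum_perm_extending M (row χ) (col χ) (row_injective χ) (col_injective χ)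
    ((freeRows χ).orderEmbOfFin rfl) ((freeCols χ).orderEmbOfFin (card_freeCols χ))
    (OrderEmbedding.strictMono _) (OrderEmbedding.strictMono _)
    (by rw [Finset.range_orderEmbOfFin]; simp [freeRows])
    (by rw [Finset.range_orderEmbOfFin]; simp [freeCols])
  have hs : ((((∏ e, edgeSign χ e) * matchingSign χ : ℤˣ) : ℤ) : ℂ) =
      (∏ e, (-1 : ℂ) ^ ((row χ e : ℕ) + (col χ e : ℕ))) *
        (-1 : ℂ) ^ #{p : Edge T × Edge T | row χ p.1 < row χ p.2 ∧ col χ p.2 < col χ p.1} := by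
    simp only [neg_one_pow_row_add_col, matchingSign]
    push_cast
    congr
  rw [hs, ← h]
  unfold freeRows
  congr!

end Signs

/-! ### Both sides as sums over permutations -/

section Expansion

variable {Ω : Type*} [Fintype Ω] [LinearOrder Ω] {n : ℕ}

/-- The matrix of the Green's functions, with rows and columns numbered consecutively. -/
def greenNumbered (β : ℝ) (h : Matrix Ω Ω ℂ) (P : Fin (n + 1) → Interaction Ω)
    (τ : Fin (n + 1) → ℝ) : Matrix (Fin (∑ i, (P i).m)) (Fin (∑ i, (P i).m)) ℂ :=
  (greenMatrix β h P τ).submatrix finSigmaFinEquiv.symm finSigmaFinEquiv.symm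

theorem propagator_eq (β : ℝ) (h : Matrix Ω Ω ℂ) {P : Fin (n + 1) → Interaction Ω}
    (τ : Fin (n + 1) → ℝ) {T : LabeledTree (n + 1)} (χ : Assignment P T) (e : Edge T) :
    propagator β h τ χ e = greenNumbered β h P τ (row χ e) (col χ e) := by
  rw [greenNumbered, Matrix.submatrix_apply, row, col, pos, pos, Equiv.symm_apply_apply,
    Equiv.symm_apply_apply, annihLeg, creatLeg, propagator]
  split_ifs <;> rfl

theorem weightedGreen_apply (β : ℝ) (h : Matrix Ω Ω ℂ) (P : Fin (n + 1) → Interaction Ω)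
    (τ : Fin (n + 1) → ℝ) (ω : Equiv.Perm (Fin (n + 1))) (t : Fin n → ℝ)
    (x y : Fin (∑ i, (P i).m)) :
    weightedGreen β h P τ ω t x y =
      (weight ω t (block P x) (block P y) : ℂ) * greenNumbered β h P τ x y := rfl

theorem cumulant_eq (β : ℝ) {h : Matrix Ω Ω ℂ} (hh : h.IsHermitian)
    (P : Fin (n + 1) → Interaction Ω) {τ : Fin (n + 1) → ℝ} (hτ : Function.Injective τ) :
    cumulant β h P τ = (∏ i, ((interactionSign (P i) : ℤ) : ℂ)) *
      ∑ Q : Finpartition (univ : Finset (Fin (n + 1))),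
        (-1 : ℂ) ^ (#Q.parts - 1) * ((#Q.parts - 1).factorial : ℂ) *
          ∏ B ∈ Q.parts, ((greenNumbered β h P τ).submatrix
            (Subtype.val : {x // block P x ∈ B} → _) Subtype.val).det := by
  rw [cumulant, Finset.mul_sum]
  refine Finset.sum_congr rfl fun Q _ => ?_
  have h1 : ∏ B ∈ Q.parts, correlation β h P τ B =
      (∏ i, ((interactionSign (P i) : ℤ) : ℂ)) * ∏ B ∈ Q.parts, ((greenNumbered β h P τ).submatrix
        (Subtype.val : {x // block P x ∈ B} → _) Subtype.val).det := by
    have h2 : ∏ i, ((interactionSign (P i) : ℤ) : ℂ) =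
        ∏ B ∈ Q.parts, ∏ i ∈ B, ((interactionSign (P i) : ℤ) : ℂ) := by
      conv_lhs => rw [← Q.biUnion_parts]
      exact Finset.prod_biUnion Q.disjoint
    rw [h2, ← Finset.prod_mul_distrib]
    refine Finset.prod_congr rfl fun B _ => ?_
    rw [correlation_eq_det β hh P hτ]
    congr 1
    let e : {x // block P x ∈ B} ≃ {x : (i : Fin (n + 1)) × Fin (P i).m // x.1 ∈ B} :=
      finSigmaFinEquiv.symm.subtypeEquiv fun x => Iff.rfl
    rw [← Matrix.det_submatrix_equiv_self e]
    rfl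
  rw [h1]
  ring

open MeasureTheory in
open scoped Classical in
theorem sign_mul_remainder (β : ℝ) (h : Matrix Ω Ω ℂ) {P : Fin (n + 1) → Interaction Ω}
    (τ : Fin (n + 1) → ℝ) {T : LabeledTree (n + 1)} (χ : Assignment P T) :
    ((treeSign χ : ℤ) : ℂ) * (∏ e : Edge T, propagator β h τ χ e) * remainder β h τ χ =
    (∏ i, ((interactionSign (P i) : ℤ) : ℂ)) *
      ∑ σ : Equiv.Perm (Fin (∑ i, (P i).m)) with (∀ e, σ (row χ e) = col χ e),
        ((Equiv.Perm.sign σ : ℤ) : ℂ) * (∏ x, greenNumbered β h P τ x (σ x)) *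
          ∑ ω : GrowingPath T, ∫ t in Set.Icc (0 : Fin n → ℝ) 1, (pathDensity T ω.1 t : ℂ) *
            ∏ x ∈ freeRows χ, (weight ω.1 t (block P x) (block P (σ x)) : ℂ) := by
  -- Propagators supply the entries of `σ` in the contracted rows and the minor those in the free
  -- rows; together they restore the full product.
  have hG : ∀ σ : Equiv.Perm (Fin (∑ i, (P i).m)), (∀ e, σ (row χ e) = col χ e) →
      ∏ x, greenNumbered β h P τ x (σ x) = (∏ e : Edge T, propagator β h τ χ e) *
        ∏ x ∈ freeRows χ, greenNumbered β h P τ x (σ x) := by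
    intro σ hσ
    rw [freeRows, ← Finset.prod_mul_prod_compl (univ.image (row χ)),
      Finset.prod_image fun _ _ _ _ e => row_injective χ e]
    congr 1
    exact Finset.prod_congr rfl fun e _ => by rw [hσ, propagator_eq]
  have hintegrable : ∀ (σ : Equiv.Perm (Fin (∑ i, (P i).m))) (ω : Equiv.Perm (Fin (n + 1))) (c : ℂ),
      IntegrableOn (fun t : Fin n → ℝ => c * ((pathDensity T ω t : ℂ) *
        ∏ x ∈ freeRows χ, (weight ω t (block P x) (block P (σ x)) : ℂ)))
        (Set.Icc (0 : Fin n → ℝ) 1) := by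
    intro σ ω c
    refine ContinuousOn.integrableOn_compact isCompact_Icc (Continuous.continuousOn ?_)
    unfold pathDensity weight
    fun_prop
  have hω : ∀ ω : Equiv.Perm (Fin (n + 1)),
      ((((∏ e, edgeSign χ e) * matchingSign χ : ℤˣ) : ℤ) : ℂ) *
        (∏ e : Edge T, propagator β h τ χ e) *
        ∫ t in Set.Icc (0 : Fin n → ℝ) 1,
          (pathDensity T ω t : ℂ) * (reducedGreen β h τ χ ω t).det =
      ∑ σ : Equiv.Perm (Fin (∑ i, (P i).m)) with (∀ e, σ (row χ e) = col χ e),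
        ((Equiv.Perm.sign σ : ℤ) : ℂ) * (∏ x, greenNumbered β h P τ x (σ x)) *
          ∫ t in Set.Icc (0 : Fin n → ℝ) 1, (pathDensity T ω t : ℂ) *
            ∏ x ∈ freeRows χ, (weight ω t (block P x) (block P (σ x)) : ℂ) := by
    intro ω
    simp only [← integral_const_mul]
    rw [← integral_finsetSum _ fun σ _ => hintegrable σ ω _]
    congr 1
    funext t
    have hdet := sign_mul_det_minor χ (weightedGreen β h P τ ω t)
    calc _ = (∏ e : Edge T, propagator β h τ χ e) * (pathDensity T ω t : ℂ) *
          (((((∏ e, edgeSign χ e) * matchingSign χ : ℤˣ) : ℤ) : ℂ) *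
            (reducedGreen β h τ χ ω t).det) := by ring
      _ = _ := by
        rw [reducedGreen, hdet, Finset.mul_sum]
        refine Finset.sum_congr rfl fun σ hσ => ?_
        rw [hG σ (mem_filter.1 hσ).2]
        simp only [weightedGreen_apply, Finset.prod_mul_distrib]
        ring
  have hsign : ((treeSign χ : ℤ) : ℂ) = (∏ i, ((interactionSign (P i) : ℤ) : ℂ)) *
      ((((∏ e, edgeSign χ e) * matchingSign χ : ℤˣ) : ℤ) : ℂ) := by
    rw [treeSign, mul_assoc]
    push_cast
    rfl
  rw [hsign, remainder, mul_assoc, mul_assoc]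
  congr 1
  rw [← mul_assoc, Finset.mul_sum, Finset.sum_congr rfl fun ω _ => hω ω.1, Finset.sum_comm]
  refine Finset.sum_congr rfl fun σ _ => ?_
  rw [Finset.mul_sum]

end Expansion
end Assembly

end TreeDet

end

/-! ### The tree-determinant expansion -/

open TreeDet in
theorem theorem4p6 {Ω : Type*} [Fintype Ω] [LinearOrder Ω]
    (β : ℝ) (h : Matrix Ω Ω ℂ) (hh : h.IsHermitian)
    (n : ℕ) (P : Fin (n + 1) → Interaction Ω)
    (τ : Fin (n + 1) → ℝ) (hτ : Function.Injective τ) :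
    cumulant β h P τ =
      ∑ T : LabeledTree (n + 1), ∑ χ : Assignment P T,
        ((treeSign χ : ℤ) : ℂ) * (∏ e : Edge T, propagator β h τ χ e) * remainder β h τ χ := by
  classical
  rw [cumulant_eq β hh P hτ, connected_part_det]
  simp only [sign_mul_remainder, ← Finset.mul_sum]
  congr 1
  -- The connectedness indicator of each `σ` is replaced by its total weight in the tree expansion;
  -- only the order of summation then differs.
  simp only [← sum_trees_integral, Finset.mul_sum, Finset.sum_filter]
  rw [Finset.sum_comm]
  refine Finset.sum_congr rfl fun T _ => ?_
  rw [Finset.sum_comm]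
  refine Finset.sum_congr rfl fun χ _ => Finset.sum_congr rfl fun σ _ => ?_
  split_ifs <;> simp [Finset.mul_sum]
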